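/- \textbf{Setting.} For a real $m\times n$ matrix $M$ let $\sigma_1(M)\ge\sigma_2(M)\ge\dots\ge 0$ be its singular values ($\sigma_k(M)=0$ for $k>\operatorname{rank} M$), let $M=\sum_{i\le \operatorname{rank} M}\sigma_i(M)\,u_iv_i^\top$ be a singular value decomposition, and let $M_p=\sum_{i\le \min(p,\operatorname{rank} M)}\sigma_i(M)\,u_iv_i^\top$ be the corresponding best rank-$p$ approximation. $\|\cdot\|$ is the spectral norm. \textbf{Theorem.} Let $m\le n$, let $A$ be a deterministic real $m\times n$ matrix of rank $r$, let $1\le p\le r$, and write $\sigma_p=\sigma_p(A)$ and $\delta_p=\sigma_p(A)-\sigma_{p+1}(A)$, where $\delta_p>0$. Let $E=(\xi_{ij})$ be a random $m\times n$ matrix whose entries are iid real random variables with mean $0$ and variance $1$ and with $|\xi_{ij}|\le K$ almost surely for all $i,j$. Put $\tilde A=A+E$ and $$m_4=\max_{1\le k\le n,\ 1\le l\le m}\Big\{\frac1m\sum_{i=1}^m\sigma_{ik}^4,\ \frac1n\sum_{j=1}^n\sigma_{lj}^4\Big\},\qquad \sigma_{ij}^2=\operatorname{Var}(\xi_{ij})$$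 (so that $m_4=1$ in the present iid case). For $t_1>0$ let \textbf{(C0)} be the condition $$\max\Big\{p\,\varepsilon_1,\ r^2t_1\varepsilon_2,\ \sqrt{r\eta}\Big\}\le\frac1{96},\qquad \varepsilon_1=\frac{\|E\|}{\sigma_p},\quad \varepsilon_2=\frac1{\delta_p},\quad \eta=\frac{\|E\|^2}{\sigma_p\delta_p}.$$ Then for all $t_1,t_2>0$ there is an event of probability at least $$1-r^2\exp\Big(\frac{-t_1^2/2}{4+Kt_1}\Big)-\frac{5r(r-1)(m+n)m_4}{t_2^2}$$ at every point of which the following holds: if (C0) is satisfied, then $$\|\tilde A_p-A_p\|\le 32\Big(\|E\|+r\,t_1\frac{\sigma_p}{\delta_p}+\frac{r^2t_2}{\delta_p}\Big)$$ for every choice of the singular value decompositions that define $A_p$ and $\tilde A_p$. In particular, if (C0) holds almost surely, the displayed bound holds with at least this probability. -/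

import Mathlib

open MeasureTheory ProbabilityTheory
open scoped Matrix.Norms.L2Operator

/-- The `k`-th largest singular value `σ_k` of a real matrix, for `k = 1, 2, …`; it is `0` when `k`
exceeds the number of columns. (Mathlib's list of singular values starts at the index `0`.) -/
noncomputable def singVal {m n : ℕ} (M : Matrix (Fin m) (Fin n) ℝ) (k : ℕ) : ℝ :=
  (Matrix.toEuclideanLin M).singularValues (k - 1)

/-- The singular value gap `δ_k = σ_k - σ_{k+1}`. -/
noncomputable def singGap {m n : ℕ} (M : Matrix (Fin m) (Fin n) ℝ) (k : ℕ) : ℝ :=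
  singVal M k - singVal M (k + 1)

/-- `B` is the rank `p` truncation `M_p = ∑_{i ≤ p} σ_i u_i v_iᵀ` of some singular value
decomposition `M = ∑_{i ≤ rank M} σ_i u_i v_iᵀ`. -/
def IsRankTruncation {m n : ℕ} (M : Matrix (Fin m) (Fin n) ℝ) (p : ℕ)
    (B : Matrix (Fin m) (Fin n) ℝ) : Prop :=
  ∃ (u : Fin M.rank → EuclideanSpace ℝ (Fin m)) (v : Fin M.rank → EuclideanSpace ℝ (Fin n)),
    Orthonormal ℝ u ∧ Orthonormal ℝ v ∧
    M = ∑ i : Fin M.rank, singVal M (i + 1) • Matrix.vecMulVec (u i).ofLp (v i).ofLp ∧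
    B = ∑ i ∈ Finset.univ.filter (fun i : Fin M.rank => (i : ℕ) + 1 ≤ p),
      singVal M (i + 1) • Matrix.vecMulVec (u i).ofLp (v i).ofLp

/-- Every matrix has a singular value decomposition, hence a rank `p` truncation. -/
theorem exists_isRankTruncation {m n : ℕ} (M : Matrix (Fin m) (Fin n) ℝ) (p : ℕ) :
    ∃ B, IsRankTruncation M p B := by
  set T := Matrix.toEuclideanLin M with hT
  have hn : Module.finrank ℝ (EuclideanSpace ℝ (Fin n)) = n := by simp
  have hrank : Module.finrank ℝ T.range = M.rank := by
    rw [Matrix.rank_eq_finrank_range_toLin M (EuclideanSpace.basisFun _ ℝ).toBasis (EuclideanSpace.basisFun _ ℝ).toBasis]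
    rw [hT, Matrix.toEuclideanLin_eq_toLin_orthonormal]
  have hle : M.rank ≤ n := by simpa using M.rank_le_width
  let b := T.isSymmetric_adjoint_comp_self.eigenvectorBasis hn
  let e : Fin M.rank → Fin n := Fin.castLE hle
  have hin : ∀ i j, inner ℝ (T (b i)) (T (b j)) = if i = j then (T.singularValues i)^2 else 0 := by
    intro i j
    rw [← LinearMap.adjoint_inner_right, ← LinearMap.comp_apply,
      LinearMap.IsSymmetric.apply_eigenvectorBasis]
    rw [inner_smul_right, orthonormal_iff_ite.1 b.orthonormal, T.sq_singularValues_fin hn]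
    split_ifs with h
    · subst h; simp
    · simp
  have hpos : ∀ i : Fin M.rank, 0 < T.singularValues i := fun i => by
    rw [T.singularValues_pos_iff_lt_finrank_range, hrank]; exact i.2
  refine ⟨_, fun i => (T.singularValues i)⁻¹ • T (b (e i)), fun i => b (e i), ?_, ?_, ?_, rfl⟩
  · rw [orthonormal_iff_ite]
    intro i j
    rw [inner_smul_left, inner_smul_right, hin]
    have := (hpos i).ne'
    by_cases h : i = j
    · subst h; simp [e]; field_simp
    · have : e i ≠ e j := fun h' => h (Fin.castLE_injective hle h')
      simp [h, this]
  · exact b.orthonormal.comp e (Fin.castLE_injective hle)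
  · have hz : ∀ i : Fin n, M.rank ≤ i → T (b i) = 0 := by
      intro i hi
      have h0 : T.singularValues i = 0 := by
        rw [T.singularValues_eq_zero_iff_le_finrank_range, hrank]; exact hi
      have := hin i i
      rw [if_pos rfl, h0] at this
      simpa using this
    apply Matrix.toEuclideanLin.injective
    apply b.toBasis.ext
    intro k
    simp only [OrthonormalBasis.coe_toBasis, map_sum, map_smul, LinearMap.sum_apply, LinearMap.smul_apply]
    have hg : ∀ (x : EuclideanSpace ℝ (Fin m)) (y z : EuclideanSpace ℝ (Fin n)),
        Matrix.toEuclideanLin (Matrix.vecMulVec x.ofLp y.ofLp) z = (inner ℝ y z : ℝ) • x := by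
      intro x y z
      ext a
      simp only [Matrix.toLpLin_apply, Matrix.vecMulVec_mulVec, PiLp.inner_apply, dotProduct]
      simp [mul_comm]
    have hv : ∀ i : Fin M.rank, Matrix.toEuclideanLin (Matrix.vecMulVec
        ((T.singularValues i)⁻¹ • T (b (e i))).ofLp (b (e i)).ofLp) (b k) =
        (if e i = k then (1 : ℝ) else 0) • ((T.singularValues i)⁻¹ • T (b (e i))) := by
      intro i
      rw [← orthonormal_iff_ite.1 b.orthonormal (e i) k]
      exact hg _ _ _
    simp only [hv, singVal, Nat.add_sub_cancel]
    by_cases hk : (k:ℕ) < M.rank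
    · rw [Finset.sum_eq_single ⟨k, hk⟩]
      · have := (hpos ⟨k,hk⟩).ne'
        simp only [e, Fin.castLE_mk, Fin.eta, if_true, smul_smul, one_mul]
        rw [← hT, mul_inv_cancel₀ this, one_smul]
      · intro j _ hj
        have : e j ≠ k := fun h => hj (by ext; simp [← h, e])
        simp [this]
      · simp
    · rw [← hT, hz k (by omega)]
      symm; apply Finset.sum_eq_zero
      intro j _
      have : e j ≠ k := fun h => hk (by rw [← h]; exact j.2)
      simp [this]

/-- Condition **(C0)** for a matrix `A` of rank `r` and a realization `E` of the noise, where
`ε₁ = ‖E‖ / σ_p`, `ε₂ = 1 / δ_p` and `η = ‖E‖² / (σ_p δ_p)` (spectral norm):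
`max {p ε₁, r² t₁ ε₂, √(r η)} ≤ 1 / 96`. It is used only when `σ_p > 0` and `δ_p > 0`. -/
def CondC0 {m n : ℕ} (A E : Matrix (Fin m) (Fin n) ℝ) (p : ℕ) (t₁ : ℝ) : Prop :=
  max (max ((p : ℝ) * (‖E‖ / singVal A p)) ((A.rank : ℝ) ^ 2 * t₁ * (1 / singGap A p)))
    (Real.sqrt ((A.rank : ℝ) * (‖E‖ ^ 2 / (singVal A p * singGap A p)))) ≤ 1 / 96

/-- `m₄ = max_{k, l} {(1/m) ∑ᵢ σ_{ik}⁴, (1/n) ∑ⱼ σ_{lj}⁴}` over all columns `k` and rows `l`, where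
`σ_{ij}²` is the variance of the `(i, j)` entry of the random matrix `E`. -/
noncomputable def mFour {Ω : Type*} [MeasurableSpace Ω] (μ : Measure Ω) {m n : ℕ}
    (E : Ω → Matrix (Fin m) (Fin n) ℝ) : ℝ :=
  max (⨆ k : Fin n, (1 / (m : ℝ)) * ∑ i : Fin m, (variance (fun ω => E ω i k) μ) ^ 2)
    (⨆ l : Fin m, (1 / (n : ℝ)) * ∑ j : Fin n, (variance (fun ω => E ω l j) μ) ^ 2)

/-! ### Orthonormal families, principal angles and truncated decompositions. -/

section SingularVectors

variable {ι κ V W : Type*} [NormedAddCommGroup V] [InnerProductSpace ℝ V]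
  [NormedAddCommGroup W] [InnerProductSpace ℝ W]

/-! The proof separates a deterministic perturbation bound from tail estimates for a few numbers:
the entries `⟪u i, E (v j)⟫`, of size at most `x`, and the off-diagonal inner products of the
vectors `Eᵀ (u i)`, and of the vectors `E (v i)`, of size at most `y`.

Write B = A + E, with singular data u', v', s. Because ‖B - B_p‖ is at most the lower bound s₀ for
the retained singular values, it suffices to show that B_p and its adjoint send vectors nearly into
the top singular spaces of A (`norm_svdPart_sub_le`). Outside span u only E contributes, at cost
‖E‖. Inside it one needs the block Z = (s_k ⟪u_j, u'_k⟫), j > p ≥ k. Combining the two singular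
vector equations gives |Z_jk| ≤ s_k / (s_k - σ_j) * (|G_jk| + |H_jk|), where G and H are the noise
blocks ⟪u_j, E v'_k⟫ and ⟪v_j, Eᵀ u'_k⟫ (`frobNorm_mul_inner_le_frobNorm_add`).

Bounding G by ‖E‖ would lose a factor σ_p / δ_p on ‖E‖. Instead, the part of v'_k outside span v is
expressed through E and s_k⁻¹, and the same is then done for u'_k. This bounds G by `x`, `y`, a
cubic term in ‖E‖, and a multiple ‖E‖² / s₀² of Z itself (`frobNorm_inner_perturbation_le`). The
smallness of r‖E‖² / (σ_p δ_p) lets this circular bound close. A min-max argument using only `x`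
controls s_p, so ‖E‖ need not be small compared with δ_p.

For the noise, a Chernoff bound gives `x` = 2t₁. The quadratic forms are split: Chebyshev bounds the
off-diagonal part by t₂, and a compensated Chernoff bound, using the control of row or column norms
by ‖E‖, bounds the diagonal part by t₁σ_p (`exists_quadratic_tail`). A union bound over pairs of
singular vectors finishes the case r ≥ 2; rank one is deterministic. -/

theorem norm_sq_sum_smul {u : ι → W} (hu : Orthonormal ℝ u) (P : Finset ι) (c : ι → ℝ) :
    ‖∑ i ∈ P, c i • u i‖ ^ 2 = ∑ i ∈ P, c i ^ 2 := by
  rw [← real_inner_self_eq_norm_sq, hu.inner_sum]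
  simp [sq]

theorem inner_sum_smul_right {u : ι → W} (hu : Orthonormal ℝ u) (P : Finset ι) (c : ι → ℝ)
    {i : ι} (hi : i ∈ P) : inner ℝ (u i) (∑ j ∈ P, c j • u j) = c i :=
  hu.inner_right_sum c hi

theorem inner_sum_smul_right_of_notMem {u : ι → W} (hu : Orthonormal ℝ u) (P : Finset ι)
    (c : ι → ℝ) {i : ι} (hi : i ∉ P) : inner ℝ (u i) (∑ j ∈ P, c j • u j) = 0 := by
  classical
  rw [inner_sum]
  refine Finset.sum_eq_zero fun j hj => ?_
  rw [inner_smul_right, orthonormal_iff_ite.1 hu, if_neg (by rintro rfl; exact hi hj), mul_zero]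

theorem sum_inner_sq_le {u : ι → W} (hu : Orthonormal ℝ u) (P : Finset ι) (x : W) :
    ∑ i ∈ P, inner ℝ (u i) x ^ 2 ≤ ‖x‖ ^ 2 := by
  simpa using hu.sum_inner_products_le x (s := P)

/-- The component of `x` along the span of the vectors `u i`, `i ∈ P`. -/
noncomputable def famProj (P : Finset ι) (u : ι → W) : W →L[ℝ] W :=
  ∑ i ∈ P, (innerSL ℝ (u i)).smulRight (u i)

/-- The component of `x` orthogonal to the vectors `u i`, `i ∈ P`. -/
noncomputable def famResid (P : Finset ι) (u : ι → W) : W →L[ℝ] W :=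
  ContinuousLinearMap.id ℝ W - famProj P u

theorem famProj_apply (P : Finset ι) (u : ι → W) (x : W) :
    famProj P u x = ∑ i ∈ P, inner ℝ (u i) x • u i := by
  simp [famProj]

theorem famResid_apply (P : Finset ι) (u : ι → W) (x : W) :
    famResid P u x = x - famProj P u x := by
  simp [famResid]

theorem famProj_add_famResid (P : Finset ι) (u : ι → W) (x : W) :
    famProj P u x + famResid P u x = x := by
  simp [famResid]

theorem inner_famProj_left (P : Finset ι) (u : ι → W) (x y : W) :
    inner ℝ (famProj P u x) y = ∑ i ∈ P, inner ℝ (u i) x * inner ℝ (u i) y := by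
  rw [famProj_apply, sum_inner]
  simp [inner_smul_left]

theorem inner_famProj_comm (P : Finset ι) (u : ι → W) (x y : W) :
    inner ℝ (famProj P u x) y = inner ℝ x (famProj P u y) := by
  rw [real_inner_comm (famProj P u y), inner_famProj_left, inner_famProj_left]
  exact Finset.sum_congr rfl fun i _ => mul_comm _ _

theorem inner_famResid_comm (P : Finset ι) (u : ι → W) (x y : W) :
    inner ℝ (famResid P u x) y = inner ℝ x (famResid P u y) := by
  rw [famResid_apply, famResid_apply, inner_sub_left, inner_sub_right, inner_famProj_comm]

theorem norm_sq_famProj {u : ι → W} (hu : Orthonormal ℝ u) (P : Finset ι) (x : W) :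
    ‖famProj P u x‖ ^ 2 = ∑ i ∈ P, inner ℝ (u i) x ^ 2 := by
  rw [famProj_apply, norm_sq_sum_smul hu]

theorem norm_sq_famProj_add {u : ι → W} (hu : Orthonormal ℝ u) (P : Finset ι) (x : W) :
    ‖famProj P u x‖ ^ 2 + ‖famResid P u x‖ ^ 2 = ‖x‖ ^ 2 := by
  have h : inner ℝ x (famProj P u x) = ‖famProj P u x‖ ^ 2 := by
    rw [real_inner_comm, inner_famProj_left, norm_sq_famProj hu]
    exact Finset.sum_congr rfl fun i _ => (sq _).symm
  rw [famResid_apply, norm_sub_sq_real, h]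
  ring

theorem norm_famProj_le {u : ι → W} (hu : Orthonormal ℝ u) (P : Finset ι) (x : W) :
    ‖famProj P u x‖ ≤ ‖x‖ :=
  abs_le_of_sq_le_sq' (by nlinarith [norm_sq_famProj_add hu P x, sq_nonneg ‖famResid P u x‖])
    (norm_nonneg _) |>.2

theorem norm_famResid_le {u : ι → W} (hu : Orthonormal ℝ u) (P : Finset ι) (x : W) :
    ‖famResid P u x‖ ≤ ‖x‖ :=
  abs_le_of_sq_le_sq' (by nlinarith [norm_sq_famProj_add hu P x, sq_nonneg ‖famProj P u x‖])
    (norm_nonneg _) |>.2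

theorem famProj_sum_smul {u : ι → W} (hu : Orthonormal ℝ u) (P : Finset ι) (c : ι → ℝ) :
    famProj P u (∑ i ∈ P, c i • u i) = ∑ i ∈ P, c i • u i := by
  rw [famProj_apply]
  exact Finset.sum_congr rfl fun i hi => by rw [inner_sum_smul_right hu P c hi]

theorem famResid_sum_smul {u : ι → W} (hu : Orthonormal ℝ u) (P : Finset ι) (c : ι → ℝ) :
    famResid P u (∑ i ∈ P, c i • u i) = 0 := by
  rw [famResid_apply, famProj_sum_smul hu, sub_self]

/-- For two families of orthonormal vectors of the same size, the largest principal angle between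
their spans does not depend on the order of the spans. -/
theorem norm_famResid_sum_le_swap {u : ι → W} {u' : κ → W} (hu : Orthonormal ℝ u)
    (hu' : Orthonormal ℝ u') {P : Finset ι} {P' : Finset κ} (hcard : P.card = P'.card)
    {τ : ℝ} (hτ : 0 ≤ τ)
    (h : ∀ c : κ → ℝ, ‖famResid P u (∑ k ∈ P', c k • u' k)‖ ≤ τ * ‖∑ k ∈ P', c k • u' k‖)
    (c : ι → ℝ) :
    ‖famResid P' u' (∑ i ∈ P, c i • u i)‖ ≤ τ * ‖∑ i ∈ P, c i • u i‖ := by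
  classical
  rcases le_or_gt 1 τ with h1 | h1
  · exact (norm_famResid_le hu' _ _).trans (le_mul_of_one_le_left (norm_nonneg _) h1)
  set y := ∑ i ∈ P, c i • u i with hy
  let ext : (P' → ℝ) → κ → ℝ := fun d k => if hk : k ∈ P' then d ⟨k, hk⟩ else 0
  have hext : ∀ d : P' → ℝ, ∑ k ∈ P', ext d k • u' k = ∑ k : P', d k • u' k := by
    intro d
    rw [← Finset.sum_coe_sort]
    exact Finset.sum_congr rfl fun k _ => by simp [ext]
  -- For τ < 1 the projection from one span to the other is injective, hence bijective by equal
  -- dimensions. Thus y is the projection of some x in the other span. Then ⟪y, x⟫ = ‖y‖² and the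
  -- bound on the residual of x bound the cosine for y from below.
  let T : (P' → ℝ) →ₗ[ℝ] (P → ℝ) :=
    { toFun := fun d i => inner ℝ (u i) (∑ k : P', d k • u' k)
      map_add' := fun d e => by
        ext i; simp [add_smul, Finset.sum_add_distrib, inner_add_right]
      map_smul' := fun a d => by
        ext i; simp [mul_smul, ← Finset.smul_sum, inner_smul_right] }
  have hproj : ∀ d : P' → ℝ, famProj P u (∑ k : P', d k • u' k) = ∑ i : P, T d i • u i := by
    intro d
    rw [famProj_apply, ← Finset.sum_coe_sort P]
    rfl
  have hinj : Function.Injective T := by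
    rw [← LinearMap.ker_eq_bot, LinearMap.ker_eq_bot']
    intro d hd
    have h0 : famProj P u (∑ k : P', d k • u' k) = 0 := by rw [hproj, hd]; simp
    have h2 := h (ext d)
    rw [hext, famResid_apply, h0, sub_zero] at h2
    have h3 : ‖∑ k : P', d k • u' k‖ = 0 := by
      nlinarith [norm_nonneg (∑ k : P', d k • u' k)]
    have h4 := norm_sq_sum_smul (hu'.comp ((↑) : P' → κ) Subtype.coe_injective) Finset.univ d
    simp only [Function.comp] at h4
    rw [h3] at h4
    ext k
    have := (Finset.sum_eq_zero_iff_of_nonneg (fun i _ => sq_nonneg (d i))).1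
      (h4.symm.trans (by norm_num)) k (Finset.mem_univ k)
    simpa using this
  have hsurj : Function.Surjective T :=
    (LinearMap.injective_iff_surjective_of_finrank_eq_finrank (by simp [hcard])).1 hinj
  obtain ⟨d, hd⟩ := hsurj (fun i => c i)
  set x := ∑ k : P', d k • u' k with hx
  have hyx : famProj P u x = y := by
    rw [hproj, hd, hy, ← Finset.sum_coe_sort P]
  have hx' : famProj P' u' x = x := by
    rw [hx, ← hext, famProj_sum_smul hu']
  have e1 := norm_sq_famProj_add hu P x
  have e2 := h (ext d)
  rw [hext, ← hx] at e2
  rw [hyx] at e1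
  have e3 := norm_sq_famProj_add hu' P' y
  have e4 : ‖y‖ ^ 2 ≤ ‖famProj P' u' y‖ * ‖x‖ := by
    have h5 : inner ℝ y x = ‖y‖ ^ 2 := by
      rw [← hyx, inner_famProj_left, norm_sq_famProj hu]
      exact Finset.sum_congr rfl fun i _ => (sq _).symm
    rw [← h5, ← hx', ← inner_famProj_comm, hx']
    exact real_inner_le_norm _ _
  set a := ‖y‖
  set b := ‖famProj P' u' y‖
  set q := ‖famResid P' u' y‖
  have hb : 0 ≤ b := norm_nonneg _
  have ha : 0 ≤ a := norm_nonneg _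
  have hq : 0 ≤ q := norm_nonneg _
  have hxn : 0 ≤ ‖x‖ := norm_nonneg _
  have e5 : ‖famResid P u x‖ ^ 2 ≤ τ ^ 2 * ‖x‖ ^ 2 := by
    rw [← mul_pow]; exact pow_le_pow_left₀ (norm_nonneg _) e2 2
  have e6 : (1 - τ ^ 2) * ‖x‖ ^ 2 ≤ a ^ 2 := by linarith
  have hτ2 : 0 < 1 - τ ^ 2 := by nlinarith
  refine (abs_le_of_sq_le_sq' ?_ (mul_nonneg hτ ha)).2
  rw [mul_pow]
  rcases ha.eq_or_lt with h0 | h0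
  · rw [← h0] at e3 ⊢; nlinarith
  have e7 : a ^ 2 * a ^ 2 ≤ b ^ 2 * ‖x‖ ^ 2 := by
    have := mul_self_le_mul_self (sq_nonneg a) e4
    nlinarith
  have e8 : (1 - τ ^ 2) * (a ^ 2 * a ^ 2) ≤ b ^ 2 * a ^ 2 := by
    calc (1 - τ ^ 2) * (a ^ 2 * a ^ 2) ≤ (1 - τ ^ 2) * (b ^ 2 * ‖x‖ ^ 2) := by gcongr
      _ = b ^ 2 * ((1 - τ ^ 2) * ‖x‖ ^ 2) := by ring
      _ ≤ b ^ 2 * a ^ 2 := by gcongr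
  have e9 : (1 - τ ^ 2) * a ^ 2 ≤ b ^ 2 := by
    have : 0 < a ^ 2 := by positivity
    nlinarith
  linarith

/-- `A = ∑ σ_i u_i v_iᵀ` with orthonormal families `u` and `v`. -/
structure IsSVD [Fintype ι] (A : V →L[ℝ] W) (u : ι → W) (v : ι → V) (σ : ι → ℝ) : Prop where
  left : Orthonormal ℝ u
  right : Orthonormal ℝ v
  apply : ∀ x, A x = ∑ i, (σ i * inner ℝ (v i) x) • u i

/-- The part `∑_{i ∈ P} σ_i u_i v_iᵀ` of a singular value decomposition. -/
noncomputable def svdPart (P : Finset ι) (u : ι → W) (v : ι → V) (σ : ι → ℝ) : V →L[ℝ] W :=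
  ∑ i ∈ P, σ i • (innerSL ℝ (v i)).smulRight (u i)

theorem svdPart_apply (P : Finset ι) (u : ι → W) (v : ι → V) (σ : ι → ℝ) (x : V) :
    svdPart P u v σ x = ∑ i ∈ P, (σ i * inner ℝ (v i) x) • u i := by
  simp [svdPart, mul_smul]

theorem adjoint_svdPart [CompleteSpace V] [CompleteSpace W] (P : Finset ι) (u : ι → W)
    (v : ι → V) (σ : ι → ℝ) :
    ContinuousLinearMap.adjoint (svdPart P u v σ) = svdPart P v u σ := by
  symm
  rw [ContinuousLinearMap.eq_adjoint_iff]
  intro x y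
  rw [svdPart_apply, svdPart_apply, sum_inner, inner_sum]
  refine Finset.sum_congr rfl fun i _ => ?_
  rw [inner_smul_left, inner_smul_right, real_inner_comm x (u i)]
  simp; ring

section
variable [Fintype ι] [Fintype κ] {A : V →L[ℝ] W} {u : ι → W} {v : ι → V} {σ : ι → ℝ}

theorem IsSVD.eq_svdPart (h : IsSVD A u v σ) : A = svdPart Finset.univ u v σ := by
  ext x; rw [h.apply, svdPart_apply]

theorem IsSVD.adjoint [CompleteSpace V] [CompleteSpace W] (h : IsSVD A u v σ) :
    IsSVD (ContinuousLinearMap.adjoint A) v u σ :=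
  ⟨h.right, h.left, fun x => by rw [h.eq_svdPart, adjoint_svdPart, svdPart_apply]⟩

theorem IsSVD.inner_left (h : IsSVD A u v σ) (i : ι) (x : V) :
    inner ℝ (u i) (A x) = σ i * inner ℝ (v i) x := by
  rw [h.apply, inner_sum_smul_right h.left _ _ (Finset.mem_univ i)]

theorem IsSVD.apply_right (h : IsSVD A u v σ) (i : ι) : A (v i) = σ i • u i := by
  classical
  rw [h.apply, Finset.sum_eq_single i]
  · simp [h.right.1 i]
  · intro j _ hj
    rw [orthonormal_iff_ite.1 h.right, if_neg hj]; simp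
  · simp

theorem IsSVD.famResid_apply_eq_zero (h : IsSVD A u v σ) (x : V) :
    famResid Finset.univ u (A x) = 0 := by
  rw [h.apply, famResid_sum_smul h.left]

/-- A perturbation bound for truncated singular value decompositions in terms of the angles. -/
theorem norm_svdPart_sub_le [CompleteSpace V] [CompleteSpace W] {B : V →L[ℝ] W}
    {u' : κ → W} {v' : κ → V} {s : κ → ℝ} (hA : IsSVD A u v σ) (hB : IsSVD B u' v' s)
    {P : Finset ι} {P' : Finset κ} (hcard : P.card = P'.card) {s₀ N : ℝ} (hs₀ : 0 < s₀)
    (hs : ∀ k ∈ P', s₀ ≤ s k) (hs' : ∀ k ∉ P', 0 ≤ s k ∧ s k ≤ s₀) (hN : 0 ≤ N)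
    (h₁ : ∀ x, ‖famResid P u (svdPart P' u' v' s x)‖ ≤ N * ‖x‖)
    (h₂ : ∀ y, ‖famResid P v (svdPart P' v' u' s y)‖ ≤ N * ‖y‖) :
    ‖svdPart P' u' v' s - svdPart P u v σ‖ ≤ 3 * N + ‖B - A‖ := by
  classical
  set Bp := svdPart P' u' v' s with hBp
  refine ContinuousLinearMap.opNorm_le_bound _ (by positivity) fun x => ?_
  set q := famProj P v x with hq
  have hqx : ‖q‖ ≤ ‖x‖ := norm_famProj_le hA.right P x
  have hR : ∀ z, B z - Bp z = ∑ k ∈ P'ᶜ, (s k * inner ℝ (v' k) z) • u' k := by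
    intro z
    rw [hB.apply, hBp, svdPart_apply, ← Finset.sum_add_sum_compl P', add_sub_cancel_left]
  have hRn : ∀ z, ‖B z - Bp z‖ ≤ s₀ * ‖z‖ := by
    intro z
    refine (abs_le_of_sq_le_sq' ?_ (by positivity)).2
    rw [hR, norm_sq_sum_smul hB.left, mul_pow]
    calc ∑ k ∈ P'ᶜ, (s k * inner ℝ (v' k) z) ^ 2
        ≤ ∑ k ∈ P'ᶜ, s₀ ^ 2 * inner ℝ (v' k) z ^ 2 := by
          refine Finset.sum_le_sum fun k hk => ?_
          obtain ⟨ha, hb⟩ := hs' k (Finset.mem_compl.1 hk)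
          rw [mul_pow]; gcongr
      _ = s₀ ^ 2 * ∑ k ∈ P'ᶜ, inner ℝ (v' k) z ^ 2 := by rw [Finset.mul_sum]
      _ ≤ s₀ ^ 2 * ‖z‖ ^ 2 := by gcongr; exact sum_inner_sq_le hB.right _ _
  have hRres : ∀ z, famResid P' u' (B z - Bp z) = B z - Bp z := by
    intro z
    have : famProj P' u' (B z - Bp z) = 0 := by
      rw [famProj_apply]
      refine Finset.sum_eq_zero fun k hk => ?_
      rw [hR, inner_sum_smul_right_of_notMem hB.left _ _ (by simpa using hk), zero_smul]
    rw [famResid_apply, this, sub_zero]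
  -- On the retained right space Bp stretches by at least s₀, so a residual of size N becomes a sine
  -- of size N / s₀. Swapping the spans makes it usable on vectors of span u.
  have hsin : ∀ c : ι → ℝ, ‖famResid P' u' (∑ i ∈ P, c i • u i)‖ ≤
      N / s₀ * ‖∑ i ∈ P, c i • u i‖ := by
    refine norm_famResid_sum_le_swap hA.left hB.left hcard (by positivity) fun c => ?_
    have e : ∑ k ∈ P', c k • u' k = Bp (∑ k ∈ P', (c k / s k) • v' k) := by
      rw [hBp, svdPart_apply]
      refine Finset.sum_congr rfl fun k hk => ?_
      rw [inner_sum_smul_right hB.right _ _ hk, mul_div_cancel₀ _ (hs₀.trans_le (hs k hk)).ne']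
    have e2 : s₀ * ‖∑ k ∈ P', (c k / s k) • v' k‖ ≤ ‖∑ k ∈ P', c k • u' k‖ := by
      refine (abs_le_of_sq_le_sq' ?_ (norm_nonneg _)).2
      rw [mul_pow, norm_sq_sum_smul hB.right, norm_sq_sum_smul hB.left, Finset.mul_sum]
      refine Finset.sum_le_sum fun k hk => ?_
      have hk' := hs k hk
      have hpos := hs₀.trans_le hk'
      rw [div_pow, mul_div_assoc', div_le_iff₀ (by positivity), mul_comm]
      gcongr
    calc ‖famResid P u (∑ k ∈ P', c k • u' k)‖
        ≤ N * ‖∑ k ∈ P', (c k / s k) • v' k‖ := by rw [e]; exact h₁ _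
      _ = N / s₀ * (s₀ * ‖∑ k ∈ P', (c k / s k) • v' k‖) := by field_simp
      _ ≤ _ := by gcongr
  have hres : ‖Bp (famResid P v x)‖ ≤ N * ‖x‖ := by
    set z := Bp (famResid P v x) with hz
    have : ‖z‖ ^ 2 ≤ N * ‖z‖ * ‖x‖ := by
      calc ‖z‖ ^ 2 = inner ℝ z (Bp (famResid P v x)) := by rw [← hz, real_inner_self_eq_norm_sq]
        _ = inner ℝ (famResid P v (svdPart P' v' u' s z)) x := by
          rw [inner_famResid_comm, ← adjoint_svdPart, ContinuousLinearMap.adjoint_inner_left]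
        _ ≤ ‖famResid P v (svdPart P' v' u' s z)‖ * ‖x‖ := real_inner_le_norm _ _
        _ ≤ N * ‖z‖ * ‖x‖ := by gcongr; exact h₂ z
    rcases (norm_nonneg z).eq_or_lt with h0 | h0
    · rw [← h0]; positivity
    · nlinarith
  -- The sine N / s₀ meets the tail norm s₀, so s₀ cancels.
  have hmid : ‖famProj P u (B q - Bp q)‖ ≤ N * ‖q‖ := by
    set z := famProj P u (B q - Bp q) with hz
    have : ‖z‖ ^ 2 ≤ N * ‖z‖ * ‖q‖ := by
      calc ‖z‖ ^ 2 = inner ℝ z (B q - Bp q) := by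
            rw [← real_inner_self_eq_norm_sq]
            nth_rewrite 2 [hz]
            rw [← inner_famProj_comm, hz, famProj_apply P u (B q - Bp q),
              famProj_sum_smul hA.left]
        _ = inner ℝ (famResid P' u' z) (B q - Bp q) := by
          rw [inner_famResid_comm, hRres]
        _ ≤ ‖famResid P' u' z‖ * ‖B q - Bp q‖ := real_inner_le_norm _ _
        _ ≤ (N / s₀ * ‖z‖) * (s₀ * ‖q‖) := by
          gcongr
          · rw [hz, famProj_apply]; exact hsin _
          · exact hRn q
        _ = N * ‖z‖ * ‖q‖ := by field_simp
    rcases (norm_nonneg z).eq_or_lt with h0 | h0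
    · rw [← h0]; positivity
    · nlinarith
  have hAp : svdPart P u v σ x = famProj P u (A q) := by
    rw [svdPart_apply, famProj_apply]
    refine Finset.sum_congr rfl fun i hi => ?_
    rw [hA.inner_left, hq, famProj_apply, inner_sum_smul_right hA.right _ _ hi]
  -- With q the projection of x, the truncation of A is famProj (A q), and A q is traded for B q -
  -- (B - A) q. The first three terms cost N each, the last ‖B - A‖.
  have hdec : (Bp - svdPart P u v σ) x = famResid P u (Bp x) + famProj P u (Bp (famResid P v x))
      - famProj P u (B q - Bp q) + famProj P u ((B - A) q) := by
    have hx : Bp x = Bp q + Bp (famResid P v x) := by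
      rw [← map_add, hq, famProj_add_famResid]
    have h3 := famProj_add_famResid P u (Bp x)
    have h4 : famProj P u (Bp x) = famProj P u (Bp q) + famProj P u (Bp (famResid P v x)) := by
      rw [hx, map_add]
    calc (Bp - svdPart P u v σ) x
        = famProj P u (Bp x) + famResid P u (Bp x) - famProj P u (A q) := by
          rw [h3, sub_apply, hAp]
      _ = _ := by
        rw [h4]; simp only [map_sub, sub_apply]; abel
  rw [hdec]
  calc _ ≤ ‖famResid P u (Bp x)‖ + ‖famProj P u (Bp (famResid P v x))‖
      + ‖famProj P u (B q - Bp q)‖ + ‖famProj P u ((B - A) q)‖ :=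
        (norm_add_le _ _).trans (add_le_add_left ((norm_sub_le _ _).trans
          (add_le_add_left (norm_add_le _ _) _)) _)
    _ ≤ N * ‖x‖ + N * ‖x‖ + N * ‖x‖ + ‖B - A‖ * ‖x‖ := by
      gcongr
      · exact h₁ x
      · exact (norm_famProj_le hA.left _ _).trans hres
      · exact hmid.trans (by gcongr)
      · exact (norm_famProj_le hA.left _ _).trans
          ((ContinuousLinearMap.le_opNorm _ _).trans (by gcongr))
    _ = _ := by ring

end

end SingularVectors

/-! ### Frobenius norms of blocks. -/

section Frobenius

variable {ι κ : Type*} (J : Finset ι) (K : Finset κ)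

/-- The Frobenius norm of the submatrix of `f` with rows in `J` and columns in `K`. -/
noncomputable def frobNorm (f : ι → κ → ℝ) : ℝ :=
  ‖(WithLp.toLp 2 (fun q : J × K => f q.1 q.2) : EuclideanSpace ℝ (J × K))‖

theorem frobNorm_nonneg (f : ι → κ → ℝ) : 0 ≤ frobNorm J K f := norm_nonneg _

theorem sq_frobNorm (f : ι → κ → ℝ) :
    frobNorm J K f ^ 2 = ∑ j ∈ J, ∑ k ∈ K, f j k ^ 2 := by
  rw [frobNorm, EuclideanSpace.norm_sq_eq, Fintype.sum_prod_type, ← Finset.sum_coe_sort J]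
  refine Finset.sum_congr rfl fun j _ => ?_
  rw [← Finset.sum_coe_sort K]
  simp

theorem frobNorm_add_le (f g : ι → κ → ℝ) :
    frobNorm J K (fun j k => f j k + g j k) ≤ frobNorm J K f + frobNorm J K g :=
  norm_add_le (WithLp.toLp 2 (fun q : J × K => f q.1 q.2) : EuclideanSpace ℝ (J × K))
    (WithLp.toLp 2 (fun q : J × K => g q.1 q.2))

theorem frobNorm_le_of_sq_le {f : ι → κ → ℝ} {c : ℝ} (hc : 0 ≤ c)
    (h : ∑ j ∈ J, ∑ k ∈ K, f j k ^ 2 ≤ c ^ 2) : frobNorm J K f ≤ c :=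
  (abs_le_of_sq_le_sq' (by rwa [sq_frobNorm]) hc).2

variable {J K} in
theorem frobNorm_le_mul {f g : ι → κ → ℝ} {c : ℝ} (hc : 0 ≤ c)
    (h : ∀ j ∈ J, ∀ k ∈ K, |f j k| ≤ c * |g j k|) : frobNorm J K f ≤ c * frobNorm J K g := by
  refine frobNorm_le_of_sq_le J K (mul_nonneg hc (frobNorm_nonneg _ _ _)) ?_
  rw [mul_pow, sq_frobNorm, Finset.mul_sum]
  refine Finset.sum_le_sum fun j hj => ?_
  rw [Finset.mul_sum]
  refine Finset.sum_le_sum fun k hk => ?_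
  rw [← sq_abs (f j k), ← sq_abs (g j k), ← mul_pow]
  exact pow_le_pow_left₀ (abs_nonneg _) (h j hj k hk) 2

theorem frobNorm_abs (f : ι → κ → ℝ) : frobNorm J K (fun j k => |f j k|) = frobNorm J K f := by
  refine (sq_eq_sq₀ (frobNorm_nonneg _ _ _) (frobNorm_nonneg _ _ _)).1 ?_
  simp [sq_frobNorm]

variable {J K} in
theorem frobNorm_le_of_rows {f : ι → κ → ℝ} {N : ℕ} {c : ℝ} (hc : 0 ≤ c) (hJ : J.card ≤ N)
    (h : ∀ j ∈ J, ∑ k ∈ K, f j k ^ 2 ≤ N * c ^ 2) : frobNorm J K f ≤ N * c := by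
  refine frobNorm_le_of_sq_le J K (by positivity) ?_
  calc ∑ j ∈ J, ∑ k ∈ K, f j k ^ 2 ≤ ∑ j ∈ J, (N : ℝ) * c ^ 2 := Finset.sum_le_sum h
    _ = J.card * (N * c ^ 2) := by simp
    _ ≤ N * (N * c ^ 2) := by gcongr
    _ = _ := by ring

end Frobenius

/-! ### Singular values and noise blocks of a perturbed operator. -/

section Perturbation

variable {ι κ V W : Type*} [NormedAddCommGroup V] [InnerProductSpace ℝ V]
  [NormedAddCommGroup W] [InnerProductSpace ℝ W]
  [Fintype ι] [Fintype κ] {A B E : V →L[ℝ] W} {u : ι → W} {v : ι → V} {σ : ι → ℝ}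
  {u' : κ → W} {v' : κ → V} {s : κ → ℝ}

/-- A lower bound for singular values of a perturbed operator. -/
theorem sub_le_of_isSVD_add (hA : IsSVD A u v σ) (hB : IsSVD B u' v' s) (hE : B = A + E)
    {P : Finset ι} {K₁ : Finset κ} (hcard : K₁.card < P.card) {σp s₀ x : ℝ} (hσp : 0 ≤ σp)
    (hσ : ∀ i ∈ P, σp ≤ σ i) (hs : ∀ k ∉ K₁, 0 ≤ s k ∧ s k ≤ s₀) (hs₀ : 0 ≤ s₀)
    (hx : 0 ≤ x) (hxE : ∀ i j, |inner ℝ (u i) (E (v j))| ≤ x) :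
    σp - P.card * x ≤ s₀ := by
  classical
  let T : (P → ℝ) →ₗ[ℝ] (K₁ → ℝ) :=
    { toFun := fun d k => inner ℝ (v' k) (∑ i : P, d i • v i)
      map_add' := fun d e => by
        ext i; simp [add_smul, Finset.sum_add_distrib, inner_add_right]
      map_smul' := fun a d => by
        ext i; simp [mul_smul, ← Finset.smul_sum, inner_smul_right] }
  -- Dimension count of min-max: some nonzero y in the span of the v i, i ∈ P, is orthogonal to the
  -- fewer vectors v' k, k ∈ K₁.
  obtain ⟨d, hd, hd0⟩ := (Submodule.ne_bot_iff _).1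
    (LinearMap.ker_ne_bot_of_finrank_lt (f := T) (by simpa using hcard))
  let c : ι → ℝ := fun i => if h : i ∈ P then d ⟨i, h⟩ else 0
  have hc : ∑ i ∈ P, c i • v i = ∑ i : P, d i • v i := by
    rw [← Finset.sum_coe_sort P]
    exact Finset.sum_congr rfl fun i _ => by simp [c]
  set y := ∑ i ∈ P, c i • v i with hy
  have hyn : ‖y‖ ^ 2 = ∑ i ∈ P, c i ^ 2 := norm_sq_sum_smul hA.right P c
  have hy0 : 0 < ‖y‖ := by
    rw [norm_pos_iff]
    intro h0
    rw [h0] at hyn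
    apply hd0
    ext i
    have := (Finset.sum_eq_zero_iff_of_nonneg (fun i _ => sq_nonneg (c i))).1
      (hyn.symm.trans (by norm_num)) i i.2
    simpa [c] using this
  have hker : ∀ k ∈ K₁, inner ℝ (v' k) y = 0 := by
    intro k hk
    have := congrFun (LinearMap.mem_ker.1 hd) ⟨k, hk⟩
    rw [hc]; exact this
  have hup : ‖B y‖ ≤ s₀ * ‖y‖ := by
    refine (abs_le_of_sq_le_sq' ?_ (by positivity)).2
    rw [hB.apply, norm_sq_sum_smul hB.left, mul_pow]
    calc ∑ k, (s k * inner ℝ (v' k) y) ^ 2 ≤ ∑ k, s₀ ^ 2 * inner ℝ (v' k) y ^ 2 := by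
          refine Finset.sum_le_sum fun k _ => ?_
          rw [mul_pow]
          by_cases hk : k ∈ K₁
          · rw [hker k hk]; simp
          · obtain ⟨ha, hb⟩ := hs k hk
            gcongr
      _ = s₀ ^ 2 * ∑ k, inner ℝ (v' k) y ^ 2 := by rw [Finset.mul_sum]
      _ ≤ s₀ ^ 2 * ‖y‖ ^ 2 := by gcongr; exact sum_inner_sq_le hB.right _ _
  have hlow : σp * ‖y‖ ≤ ‖famProj P u (A y)‖ := by
    refine (abs_le_of_sq_le_sq' ?_ (norm_nonneg _)).2
    rw [norm_sq_famProj hA.left, mul_pow, hyn, Finset.mul_sum]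
    refine Finset.sum_le_sum fun i hi => ?_
    rw [hA.inner_left, inner_sum_smul_right hA.right _ _ hi, mul_pow]
    have := hσ i hi
    gcongr
  -- Projecting onto the u i, i ∈ P, leaves only the P × P block of E in play, whose Frobenius norm
  -- is at most |P| x; this replaces Weyl's ‖E‖.
  have hEy : ‖famProj P u (E y)‖ ≤ P.card * x * ‖y‖ := by
    refine (abs_le_of_sq_le_sq' ?_ (by positivity)).2
    rw [norm_sq_famProj hA.left]
    calc ∑ i ∈ P, inner ℝ (u i) (E y) ^ 2 ≤ ∑ i ∈ P, P.card * x ^ 2 * ‖y‖ ^ 2 := by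
          refine Finset.sum_le_sum fun i _ => ?_
          rw [hy, map_sum, inner_sum]
          simp only [map_smul, inner_smul_right]
          refine (Finset.sum_mul_sq_le_sq_mul_sq P c _).trans ?_
          rw [← hy, hyn, mul_comm]
          gcongr
          refine (Finset.sum_le_card_nsmul P _ (x ^ 2) fun l _ => ?_).trans_eq (by simp)
          rw [← sq_abs]
          exact pow_le_pow_left₀ (abs_nonneg _) (hxE i l) 2
      _ = _ := by simp; ring
  have : σp * ‖y‖ ≤ s₀ * ‖y‖ + P.card * x * ‖y‖ := by
    have h1 : famProj P u (A y) = famProj P u (B y) - famProj P u (E y) := by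
      rw [hE, ← map_sub]; simp
    calc _ ≤ _ := hlow
      _ ≤ ‖famProj P u (B y)‖ + ‖famProj P u (E y)‖ := by rw [h1]; exact norm_sub_le _ _
      _ ≤ _ := add_le_add ((norm_famProj_le hA.left _ _).trans hup) hEy
  nlinarith

theorem norm_sq_famProj_le_card_mul (hv : Orthonormal ℝ v) {x : ℝ} {w : V}
    (hx : ∀ i, |inner ℝ w (v i)| ≤ x) :
    ‖famProj Finset.univ v w‖ ^ 2 ≤ Fintype.card ι * x ^ 2 := by
  rw [norm_sq_famProj hv]
  refine (Finset.sum_le_card_nsmul _ _ (x ^ 2) fun l _ => ?_).trans_eq (by simp)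
  rw [← sq_abs, real_inner_comm]
  exact pow_le_pow_left₀ (abs_nonneg _) (hx l) 2

variable [CompleteSpace V] [CompleteSpace W]

/-- Since A maps into span u and its adjoint into span v, the residuals obey s_k · resid(v'_k) =
resid(Eᵀ u'_k) and s_k · resid(u'_k) = resid(E v'_k). Applying these in turn expands ⟪u_j, E v'_k⟫
into entries of E in the singular bases, off-diagonal inner products of the Eᵀ u_i, and a remainder
cubic in E. The diagonal product ‖Eᵀ u_j‖² is not small and multiplies ⟪u_j, u'_k⟫, which is why the
block being estimated reappears on the right. -/
theorem frobNorm_inner_perturbation_le (hA : IsSVD A u v σ) (hB : IsSVD B u' v' s)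
    (hE : B = A + E) {J : Finset ι} {P' : Finset κ} (hP' : P'.card ≤ Fintype.card ι)
    {s₀ x y : ℝ} (hs₀ : 0 < s₀) (hs : ∀ k ∈ P', s₀ ≤ s k) (hx : 0 ≤ x) (hy : 0 ≤ y)
    (hxE : ∀ i j, |inner ℝ (u i) (E (v j))| ≤ x)
    (hyE : ∀ i j, i ≠ j →
      |inner ℝ (ContinuousLinearMap.adjoint E (u i)) (ContinuousLinearMap.adjoint E (u j))| ≤ y) :
    frobNorm J P' (fun j k => inner ℝ (u j) (E (v' k))) ≤
      Fintype.card ι * (x * (1 + ‖E‖ / s₀) + y / s₀ + ‖E‖ ^ 3 / s₀ ^ 2) +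
      ‖E‖ ^ 2 / s₀ ^ 2 * frobNorm J P' (fun j k => s k * inner ℝ (u j) (u' k)) := by
  classical
  have hEx : ∀ z, ‖E z‖ ≤ ‖E‖ * ‖z‖ := E.le_opNorm
  have hEy : ∀ z, ‖ContinuousLinearMap.adjoint E z‖ ≤ ‖E‖ * ‖z‖ := fun z => by
    have := (ContinuousLinearMap.adjoint E).le_opNorm z
    rwa [LinearIsometryEquiv.norm_map] at this
  have hJ : J.card ≤ Fintype.card ι := Finset.card_le_univ J
  set r := Fintype.card ι with hr
  let w : ι → V := fun j => ContinuousLinearMap.adjoint E (u j)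
  have hxw : ∀ j i, |inner ℝ (w j) (v i)| ≤ x := fun j i => by
    simpa only [w, ContinuousLinearMap.adjoint_inner_left] using hxE j i
  let pw : ι → V := fun j => famProj Finset.univ v (w j)
  have hpw : ∀ j, ‖pw j‖ ^ 2 ≤ r * x ^ 2 := fun j => norm_sq_famProj_le_card_mul hA.right (hxw j)
  let a : ι → κ → ℝ := fun j k => inner ℝ (v' k) (pw j)
  let b : ι → κ → ℝ := fun j k => inner ℝ (u' k) (E (pw j))
  let o : ι → κ → ℝ := fun j k =>
    inner ℝ (u' k) (∑ i ∈ Finset.univ.erase j, inner ℝ (w j) (w i) • u i)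
  let m : ι → κ → ℝ := fun j k =>
    inner ℝ (u j) (E (ContinuousLinearMap.adjoint E (famResid Finset.univ u (E (v' k)))))
  let Z : ι → κ → ℝ := fun j k => s k * inner ℝ (u j) (u' k)
  have ha : frobNorm J P' a ≤ r * x :=
    frobNorm_le_of_rows hx hJ fun j _ => (sum_inner_sq_le hB.right _ _).trans (hpw j)
  have hb : frobNorm J P' b ≤ r * (‖E‖ * x) := by
    refine frobNorm_le_of_rows (by positivity) hJ fun j _ =>
      (sum_inner_sq_le hB.left _ _).trans ?_
    calc ‖E (pw j)‖ ^ 2 ≤ (‖E‖ * ‖pw j‖) ^ 2 := by gcongr; exact hEx _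
      _ = ‖E‖ ^ 2 * ‖pw j‖ ^ 2 := by ring
      _ ≤ ‖E‖ ^ 2 * (r * x ^ 2) := by gcongr; exact hpw j
      _ = _ := by ring
  have ho : frobNorm J P' o ≤ r * y := by
    refine frobNorm_le_of_rows hy hJ fun j _ => (sum_inner_sq_le hB.left _ _).trans ?_
    rw [norm_sq_sum_smul hA.left]
    calc ∑ i ∈ Finset.univ.erase j, inner ℝ (w j) (w i) ^ 2
        ≤ ∑ i ∈ Finset.univ.erase j, y ^ 2 := by
          refine Finset.sum_le_sum fun i hi => ?_
          rw [← sq_abs]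
          exact pow_le_pow_left₀ (abs_nonneg _) (hyE j i (Finset.ne_of_mem_erase hi).symm) 2
      _ ≤ ∑ i : ι, y ^ 2 :=
          Finset.sum_le_sum_of_subset_of_nonneg (Finset.erase_subset _ _)
            fun _ _ _ => sq_nonneg y
      _ = r * y ^ 2 := by simp [hr]
  have hm : frobNorm J P' m ≤ r * ‖E‖ ^ 3 := by
    refine frobNorm_le_of_sq_le _ _ (by positivity) ?_
    -- Bessel is applied over j for each fixed k, and there are at most r columns. The further
    -- factor r is given away to match the other terms.
    rw [Finset.sum_comm]
    calc ∑ k ∈ P', ∑ j ∈ J, m j k ^ 2 ≤ ∑ k ∈ P', (‖E‖ ^ 3) ^ 2 := by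
          refine Finset.sum_le_sum fun k _ => (sum_inner_sq_le hA.left _ _).trans ?_
          refine pow_le_pow_left₀ (norm_nonneg _) ?_ 2
          calc _ ≤ ‖E‖ * (‖E‖ * (‖E‖ * ‖v' k‖)) :=
                (hEx _).trans (by
                  gcongr
                  exact (hEy _).trans (by
                    gcongr; exact (norm_famResid_le hA.left _ _).trans (hEx _)))
            _ = ‖E‖ ^ 3 := by rw [hB.right.1 k]; ring
      _ = P'.card * (‖E‖ ^ 3) ^ 2 := by simp
      _ ≤ r * (‖E‖ ^ 3) ^ 2 := by gcongr
      _ ≤ r * (r * (‖E‖ ^ 3) ^ 2) := by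
          rcases Nat.eq_zero_or_pos r with h0 | h0
          · simp [h0]
          · have : (1 : ℝ) ≤ r := by exact_mod_cast h0
            exact mul_le_mul_of_nonneg_left (le_mul_of_one_le_left (by positivity) this)
              (by positivity)
      _ = _ := by ring
  -- The two residual substitutions, cleared of denominators: `a` and `b` come from projecting onto
  -- span v, `o` and the ‖w j‖² term from projecting u' k onto span u, and `m` from its residual.
  have key : ∀ j k, s k ^ 2 * inner ℝ (u j) (E (v' k)) =
      s k ^ 2 * a j k - s k * b j k + s k * o j k + ‖w j‖ ^ 2 * Z j k + m j k := by
    intro j k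
    have e1 : inner ℝ (u j) (E (v' k)) =
        a j k + inner ℝ (w j) (famResid Finset.univ v (v' k)) := by
      rw [← ContinuousLinearMap.adjoint_inner_left]
      change inner ℝ (w j) _ = _
      nth_rewrite 1 [← famProj_add_famResid Finset.univ v (v' k)]
      rw [inner_add_right, ← inner_famProj_comm, real_inner_comm]
    have e2 : s k • famResid Finset.univ v (v' k) =
        famResid Finset.univ v (ContinuousLinearMap.adjoint E (u' k)) := by
      rw [← map_smul, ← hB.adjoint.apply_right, hE, map_add, add_apply,
        map_add, hA.adjoint.famResid_apply_eq_zero, zero_add]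
    have e3 : s k • famResid Finset.univ u (u' k) = famResid Finset.univ u (E (v' k)) := by
      rw [← map_smul, ← hB.apply_right, hE, add_apply,
        map_add, hA.famResid_apply_eq_zero, zero_add]
    have e4 : s k * inner ℝ (w j) (famResid Finset.univ v (v' k)) =
        inner ℝ (w j) (ContinuousLinearMap.adjoint E (u' k)) - b j k := by
      rw [← inner_smul_right, e2, famResid_apply, inner_sub_right, ← inner_famProj_comm,
        ContinuousLinearMap.adjoint_inner_right E (famProj _ _ _), real_inner_comm (u' k)]
    have e5 : inner ℝ (w j) (ContinuousLinearMap.adjoint E (u' k)) =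
        inner ℝ (w j) (ContinuousLinearMap.adjoint E (famProj Finset.univ u (u' k))) +
        inner ℝ (w j) (ContinuousLinearMap.adjoint E (famResid Finset.univ u (u' k))) := by
      nth_rewrite 1 [← famProj_add_famResid Finset.univ u (u' k)]
      rw [map_add, inner_add_right]
    have e6 : s k * inner ℝ (w j)
        (ContinuousLinearMap.adjoint E (famResid Finset.univ u (u' k))) = m j k := by
      rw [← inner_smul_right, ← map_smul, e3, ContinuousLinearMap.adjoint_inner_left]
    have e7 : inner ℝ (w j) (ContinuousLinearMap.adjoint E (famProj Finset.univ u (u' k))) =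
        ‖w j‖ ^ 2 * inner ℝ (u j) (u' k) + o j k := by
      rw [famProj_apply, map_sum, inner_sum]
      simp only [o, inner_sum, map_smul, inner_smul_right]
      rw [← Finset.add_sum_erase _ _ (Finset.mem_univ j)]
      congr 1
      · change _ * inner ℝ (w j) (w j) = _
        rw [real_inner_self_eq_norm_sq]; ring
      · refine Finset.sum_congr rfl fun i _ => ?_
        rw [real_inner_comm (u i)]; exact mul_comm _ _
    have e8 : s k * (s k * inner ℝ (w j) (famResid Finset.univ v (v' k))) =
        s k * (‖w j‖ ^ 2 * inner ℝ (u j) (u' k)) + s k * o j k + m j k - s k * b j k := by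
      rw [e4, e5, e7, ← e6]; ring
    rw [e1]
    simp only [Z]
    linear_combination e8
  have hpt : ∀ j ∈ J, ∀ k ∈ P', |inner ℝ (u j) (E (v' k))| ≤
      1 * |(|a j k| + (s₀⁻¹ * |b j k| + (s₀⁻¹ * |o j k| +
        (‖E‖ ^ 2 / s₀ ^ 2 * |Z j k| + (s₀ ^ 2)⁻¹ * |m j k|))))| := by
    intro j _ k hk
    have hk' := hs k hk
    have hsk : 0 < s k := hs₀.trans_le hk'
    have hwj : ‖w j‖ ≤ ‖E‖ := by simpa [hA.left.1 j] using hEy (u j)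
    rw [one_mul, abs_of_nonneg (a := _ + _) (by positivity)]
    have e : inner ℝ (u j) (E (v' k)) = a j k + (-((s k)⁻¹ * b j k) + ((s k)⁻¹ * o j k +
        (‖w j‖ ^ 2 / s k ^ 2 * Z j k + (s k ^ 2)⁻¹ * m j k))) := by
      have := key j k
      field_simp
      linarith
    rw [e]
    refine (abs_add_le _ _).trans (add_le_add le_rfl ((abs_add_le _ _).trans (add_le_add ?_
      ((abs_add_le _ _).trans (add_le_add ?_ ((abs_add_le _ _).trans (add_le_add ?_ ?_)))))))
    · rw [abs_neg, abs_mul, abs_of_pos (inv_pos.2 hsk)]; gcongr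
    · rw [abs_mul, abs_of_pos (inv_pos.2 hsk)]; gcongr
    · rw [abs_mul, abs_of_nonneg (a := ‖w j‖ ^ 2 / s k ^ 2) (by positivity)]; gcongr
    · rw [abs_mul, abs_of_nonneg (a := (s k ^ 2)⁻¹) (by positivity)]; gcongr
  have hsm : ∀ (c : ℝ), 0 ≤ c → ∀ f : ι → κ → ℝ,
      frobNorm J P' (fun j k => c * |f j k|) ≤ c * frobNorm J P' f := fun c hc f =>
    frobNorm_le_mul hc fun j _ k _ => by rw [abs_mul, abs_abs, abs_of_nonneg hc]
  refine (frobNorm_le_mul zero_le_one hpt).trans ?_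
  rw [one_mul]
  refine (frobNorm_add_le _ _ _ _).trans ?_
  refine (add_le_add le_rfl ((frobNorm_add_le _ _ _ _).trans (add_le_add le_rfl
    ((frobNorm_add_le _ _ _ _).trans (add_le_add le_rfl (frobNorm_add_le _ _ _ _)))))).trans ?_
  rw [frobNorm_abs]
  have g1 := (hsm s₀⁻¹ (by positivity) b).trans (mul_le_mul_of_nonneg_left hb (by positivity))
  have g2 := (hsm s₀⁻¹ (by positivity) o).trans (mul_le_mul_of_nonneg_left ho (by positivity))
  have g3 := hsm (‖E‖ ^ 2 / s₀ ^ 2) (by positivity) Z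
  have g4 := (hsm (s₀ ^ 2)⁻¹ (by positivity) m).trans
    (mul_le_mul_of_nonneg_left hm (by positivity))
  refine (add_le_add ha (add_le_add g1 (add_le_add g2 (add_le_add g3 g4)))).trans_eq ?_
  field_simp
  ring

end Perturbation

/-! ### The deterministic bound for truncations. -/

section Truncation

variable {ι κ V W : Type*} [NormedAddCommGroup V] [InnerProductSpace ℝ V]
  [NormedAddCommGroup W] [InnerProductSpace ℝ W]
  [Fintype ι] [Fintype κ] {A B E : V →L[ℝ] W} {u : ι → W} {v : ι → V} {σ : ι → ℝ}
  {u' : κ → W} {v' : κ → V} {s : κ → ℝ}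

theorem IsSVD.mul_inner_eq (hA : IsSVD A u v σ) (hB : IsSVD B u' v' s) (hE : B = A + E)
    (j : ι) (k : κ) : s k * inner ℝ (u j) (u' k) =
      σ j * inner ℝ (v j) (v' k) + inner ℝ (u j) (E (v' k)) := by
  rw [← hA.inner_left, ← inner_add_right, ← add_apply, ← hE,
    hB.apply_right, inner_smul_right]

/-- The residual splits into the components along u_j, j ∉ P, controlled by Cauchy–Schwarz and the
Frobenius block, and the part orthogonal to every u_j, which A cannot reach and which therefore
comes from E. -/
theorem norm_famResid_svdPart_le (hA : IsSVD A u v σ) (hB : IsSVD B u' v' s) (hE : B = A + E)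
    (P : Finset ι) (P' : Finset κ) [DecidableEq ι] (x : V) :
    ‖famResid P u (svdPart P' u' v' s x)‖ ≤
      (frobNorm Pᶜ P' (fun j k => s k * inner ℝ (u j) (u' k)) + ‖E‖) * ‖x‖ := by
  set z := svdPart P' u' v' s x with hz
  have h1 : famResid P u z = famProj Pᶜ u z + famResid Finset.univ u z := by
    rw [famResid_apply, famResid_apply, famProj_apply Finset.univ,
      ← Finset.sum_add_sum_compl P, ← famProj_apply, ← famProj_apply]
    abel
  have hz2 : z = B (famProj P' v' x) := by
    rw [hz, svdPart_apply, famProj_apply, map_sum]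
    refine Finset.sum_congr rfl fun k _ => ?_
    rw [map_smul, hB.apply_right, smul_smul, mul_comm]
  have h2 : ‖famResid Finset.univ u z‖ ≤ ‖E‖ * ‖x‖ := by
    rw [hz2, hE, add_apply, map_add, hA.famResid_apply_eq_zero, zero_add]
    refine (norm_famResid_le hA.left _ _).trans ((E.le_opNorm _).trans ?_)
    gcongr
    exact norm_famProj_le hB.right _ _
  have h3 : ‖famProj Pᶜ u z‖ ≤
      frobNorm Pᶜ P' (fun j k => s k * inner ℝ (u j) (u' k)) * ‖x‖ := by
    refine (abs_le_of_sq_le_sq' ?_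
      (mul_nonneg (frobNorm_nonneg _ _ _) (norm_nonneg _))).2
    rw [norm_sq_famProj hA.left, mul_pow, sq_frobNorm, Finset.sum_mul]
    refine Finset.sum_le_sum fun j _ => ?_
    have : inner ℝ (u j) z =
        ∑ k ∈ P', (s k * inner ℝ (u j) (u' k)) * inner ℝ (v' k) x := by
      rw [hz, svdPart_apply, inner_sum]
      refine Finset.sum_congr rfl fun k _ => ?_
      rw [inner_smul_right]; ring
    rw [this]
    refine (Finset.sum_mul_sq_le_sq_mul_sq P' _ _).trans ?_
    gcongr
    exact sum_inner_sq_le hB.right _ _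
  rw [h1, add_mul]
  exact (norm_add_le _ _).trans (add_le_add h3 h2)

variable [CompleteSpace V] [CompleteSpace W]

/-- Eliminating ⟪v_j, v'_k⟫ between the singular vector equations for B and its adjoint gives (s_k²
- σ_j²)⟪u_j, u'_k⟫ = s_k G_jk + σ_j H_jk. The factor s_k + σ_j absorbs the coefficients on the
right, leaving the ratio s_k / (s_k - σ_j) ≤ w. -/
theorem frobNorm_mul_inner_le_frobNorm_add (hA : IsSVD A u v σ) (hB : IsSVD B u' v' s)
    (hE : B = A + E) {J : Finset ι} {P' : Finset κ} {w : ℝ} (hw : 0 ≤ w)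
    (hσ : ∀ j ∈ J, 0 ≤ σ j) (hs : ∀ j ∈ J, ∀ k ∈ P', σ j < s k ∧ s k ≤ w * (s k - σ j)) :
    frobNorm J P' (fun j k => s k * inner ℝ (u j) (u' k)) ≤
      w * (frobNorm J P' (fun j k => inner ℝ (u j) (E (v' k))) +
        frobNorm J P' (fun j k => inner ℝ (v j) (ContinuousLinearMap.adjoint E (u' k)))) := by
  set G : ι → κ → ℝ := fun j k => inner ℝ (u j) (E (v' k)) with hG
  set H : ι → κ → ℝ := fun j k => inner ℝ (v j) (ContinuousLinearMap.adjoint E (u' k)) with hH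
  have h : ∀ j ∈ J, ∀ k ∈ P', |s k * inner ℝ (u j) (u' k)| ≤ w * |(|G j k| + |H j k|)| := by
    intro j hj k hk
    have e1 := hA.mul_inner_eq hB hE j k
    have e2 := hA.adjoint.mul_inner_eq hB.adjoint (by rw [hE, map_add]) j k
    obtain ⟨hlt, hle⟩ := hs j hj k hk
    have h0 := hσ j hj
    have hG' : inner ℝ (u j) (E (v' k)) = G j k := rfl
    have hH' : inner ℝ (v j) (ContinuousLinearMap.adjoint E (u' k)) = H j k := rfl
    rw [hG'] at e1
    rw [hH'] at e2
    set S := inner ℝ (u j) (u' k)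
    set T := inner ℝ (v j) (v' k)
    have e3 : (s k - σ j) * (s k + σ j) * (s k * S) = s k * (s k * G j k + σ j * H j k) := by
      linear_combination (s k ^ 2) * e1 + s k * σ j * e2
    have hsk : 0 < s k := h0.trans_lt hlt
    have hd : 0 < s k - σ j := sub_pos.2 hlt
    have e4 : (s k - σ j) * (s k + σ j) * |s k * S| ≤
        (s k - σ j) * (s k + σ j) * (w * (|G j k| + |H j k|)) := by
      have : (s k - σ j) * (s k + σ j) * |s k * S| = s k * |s k * G j k + σ j * H j k| := by
        rw [← abs_of_pos (a := (s k - σ j) * (s k + σ j)) (by positivity), ← abs_mul, e3, abs_mul,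
          abs_of_pos hsk]
      rw [this]
      have h5 : |s k * G j k + σ j * H j k| ≤ (s k + σ j) * (|G j k| + |H j k|) := by
        refine (abs_add_le _ _).trans ?_
        rw [abs_mul, abs_mul, abs_of_pos hsk, abs_of_nonneg h0]
        nlinarith [mul_nonneg hsk.le (abs_nonneg (H j k)), mul_nonneg h0 (abs_nonneg (G j k))]
      calc s k * |s k * G j k + σ j * H j k|
          ≤ (w * (s k - σ j)) * ((s k + σ j) * (|G j k| + |H j k|)) := by gcongr
        _ = _ := by ring
    rw [abs_of_nonneg (a := |G j k| + |H j k|) (by positivity)]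
    exact le_of_mul_le_mul_left e4 (by positivity)
  refine (frobNorm_le_mul hw h).trans ?_
  gcongr
  refine (frobNorm_add_le _ _ _ _).trans ?_
  rw [frobNorm_abs, frobNorm_abs]

/-- The real inequality that resolves the coupled bounds for the off-diagonal blocks `Z`, `Z'` and
the noise blocks `G`, `H`. -/
theorem mul_add_le_of_coupled_bounds {r : ℕ} {σp δ s₀ x y ε Z Z' G H : ℝ} (hr0 : 1 ≤ r) (hδ : 0 < δ)
    (hσp : 0 < σp) (hε0 : 0 ≤ ε) (hx : 0 ≤ x) (hy : 0 ≤ y) (hs₀' : 47 / 48 * σp ≤ s₀)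
    (hEσ : ε ≤ σp / 96) (hEδ : r * ε ^ 2 ≤ σp * δ / 9216) (hG0 : 0 ≤ G) (hH0 : 0 ≤ H)
    (hZ1 : Z ≤ 48 / 47 * σp / δ * (G + H)) (hZ2 : Z' ≤ 48 / 47 * σp / δ * (H + G))
    (hG1 : G ≤ r * (x * (1 + ε / s₀) + y / s₀ + ε ^ 3 / s₀ ^ 2) + ε ^ 2 / s₀ ^ 2 * Z)
    (hH1 : H ≤ r * (x * (1 + ε / s₀) + y / s₀ + ε ^ 3 / s₀ ^ 2) + ε ^ 2 / s₀ ^ 2 * Z') :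
    0 ≤ 48 / 47 * σp / δ * (G + H) ∧ 48 / 47 * σp / δ * (G + H) ≤
      202 / 100 * (104 / 100 * (r * x * (σp / δ)) + 105 / 100 * (r * y / δ) + 1 / 1000 * ε) := by
  have hs₀pos : 0 < s₀ := by linarith
  set w := 48 / 47 * σp / δ with hw
  have hw0 : 0 < w := by positivity
  set b := r * (x * (1 + ε / s₀) + y / s₀ + ε ^ 3 / s₀ ^ 2) with hb
  have hr1 : (1 : ℝ) ≤ r := by exact_mod_cast hr0
  have hs₀sq : (47 / 48 * σp) ^ 2 ≤ s₀ ^ 2 := by gcongr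
  -- The feedback coefficient: at most (48/47)³ / 9216, so the Z terms can be absorbed on the left,
  -- turning 2b into 2.02 b.
  have hwε : w * (ε ^ 2 / s₀ ^ 2) ≤ 1 / 1000 := by
    have h1 : ε ^ 2 ≤ σp * δ / 9216 := (le_mul_of_one_le_left (sq_nonneg ε) hr1).trans hEδ
    calc w * (ε ^ 2 / s₀ ^ 2) ≤ w * ((σp * δ / 9216) / (47 / 48 * σp) ^ 2) := by gcongr
      _ = (48 / 47) ^ 3 / 9216 := by rw [hw]; field_simp
      _ ≤ 1 / 1000 := by norm_num
  have hb0 : 0 ≤ b := by positivity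
  have hGH : G + H ≤ 202 / 100 * b := by
    have h1 : G + H ≤ 2 * b + ε ^ 2 / s₀ ^ 2 * (w * (G + H)) + ε ^ 2 / s₀ ^ 2 * (w * (H + G)) := by
      have h2 : ε ^ 2 / s₀ ^ 2 * Z ≤ ε ^ 2 / s₀ ^ 2 * (w * (G + H)) := by gcongr
      have h3 : ε ^ 2 / s₀ ^ 2 * Z' ≤ ε ^ 2 / s₀ ^ 2 * (w * (H + G)) := by gcongr
      linarith
    have h4 : w * (ε ^ 2 / s₀ ^ 2) * (G + H) ≤ 1 / 1000 * (G + H) := by gcongr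
    have h5 : G + H ≤ 2 * b + 2 * (w * (ε ^ 2 / s₀ ^ 2) * (G + H)) :=
      h1.trans_eq (by ring)
    linarith
  have hwb : w * b ≤ 104 / 100 * (r * x * (σp / δ)) + 105 / 100 * (r * y / δ) +
      1 / 1000 * ε := by
    have h1 : w * (r * (x * (1 + ε / s₀))) ≤ 104 / 100 * (r * x * (σp / δ)) := by
      have h2 : ε / s₀ ≤ 1 / 94 := by
        rw [div_le_iff₀ hs₀pos]; linarith
      calc w * (r * (x * (1 + ε / s₀))) ≤ w * (r * (x * (1 + 1 / 94))) := by gcongr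
        _ = (48 / 47 * (95 / 94)) * (r * x * (σp / δ)) := by rw [hw]; ring
        _ ≤ _ := by gcongr; norm_num
    have h2 : w * (r * (y / s₀)) ≤ 105 / 100 * (r * y / δ) := by
      calc w * (r * (y / s₀)) ≤ w * (r * (y / (47 / 48 * σp))) := by gcongr
        _ = (48 / 47) ^ 2 * (r * y / δ) := by rw [hw]; field_simp
        _ ≤ _ := by gcongr; norm_num
    have h3 : w * (r * (ε ^ 3 / s₀ ^ 2)) ≤ 1 / 1000 * ε := by
      calc w * (r * (ε ^ 3 / s₀ ^ 2)) = w * ((r * ε ^ 2) / s₀ ^ 2) * ε := by ring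
        _ ≤ w * ((σp * δ / 9216) / (47 / 48 * σp) ^ 2) * ε := by gcongr
        _ = (48 / 47) ^ 3 / 9216 * ε := by rw [hw]; field_simp
        _ ≤ _ := mul_le_mul_of_nonneg_right (by norm_num) hε0
    calc w * b = w * (r * (x * (1 + ε / s₀))) + w * (r * (y / s₀)) +
          w * (r * (ε ^ 3 / s₀ ^ 2)) := by rw [hb]; ring
      _ ≤ _ := by linarith
  refine ⟨by positivity, ?_⟩
  calc w * (G + H) ≤ w * (202 / 100 * b) := by gcongr
    _ = 202 / 100 * (w * b) := by ring
    _ ≤ _ := by gcongr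

/-- Perturbation of a truncated singular value decomposition, in terms of the entries of the
perturbation in the basis of singular vectors. -/
theorem norm_svdPart_sub_svdPart_le (hA : IsSVD A u v σ) (hB : IsSVD B u' v' s)
    (hE : B = A + E) {P : Finset ι} {P' : Finset κ} (hcard : P.card = P'.card)
    {r : ℕ} (hr : Fintype.card ι = r) {σp δ s₀ x y : ℝ}
    (hδ : 0 < δ) (hδσ : δ ≤ σp) (hσ : ∀ j ∉ P, 0 ≤ σ j ∧ σ j ≤ σp - δ)
    (hs₀ : σp - δ / 48 ≤ s₀) (hs : ∀ k ∈ P', s₀ ≤ s k) (hs' : ∀ k ∉ P', 0 ≤ s k ∧ s k ≤ s₀)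
    (hx : 0 ≤ x) (hy : 0 ≤ y) (hEσ : ‖E‖ ≤ σp / 96) (hEδ : r * ‖E‖ ^ 2 ≤ σp * δ / 9216)
    (hr0 : 1 ≤ r)
    (hxE : ∀ i j, |inner ℝ (u i) (E (v j))| ≤ x)
    (hyE : ∀ i j, i ≠ j →
      |inner ℝ (ContinuousLinearMap.adjoint E (u i)) (ContinuousLinearMap.adjoint E (u j))| ≤ y)
    (hyE' : ∀ i j, i ≠ j → |inner ℝ (E (v i)) (E (v j))| ≤ y) :
    ‖svdPart P' u' v' s - svdPart P u v σ‖ ≤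
      5 * ‖E‖ + 7 * (r * x * (σp / δ)) + 7 * (r * y / δ) := by
  classical
  have hσp : 0 < σp := hδ.trans_le hδσ
  have hs₀' : 47 / 48 * σp ≤ s₀ := by linarith
  have hs₀pos : 0 < s₀ := by linarith
  have hP' : P'.card ≤ Fintype.card ι := hcard ▸ Finset.card_le_univ P
  have hEadj : ContinuousLinearMap.adjoint B =
      ContinuousLinearMap.adjoint A + ContinuousLinearMap.adjoint E := by rw [hE, map_add]
  set ε := ‖E‖ with hε
  have hε0 : 0 ≤ ε := norm_nonneg _
  have hnadj : ‖ContinuousLinearMap.adjoint E‖ = ε := LinearIsometryEquiv.norm_map _ _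
  -- The ratio s_k / (s_k - σ_j) is worst at s_k = σp - δ/48, σ_j = σp - δ, where the gap is 47δ/48.
  set w := 48 / 47 * σp / δ with hw
  have hw0 : 0 < w := by positivity
  have hgap : ∀ j ∈ Pᶜ, ∀ k ∈ P', σ j < s k ∧ s k ≤ w * (s k - σ j) := by
    intro j hj k hk
    obtain ⟨h0, h1⟩ := hσ j (by simpa using hj)
    have h2 := hs k hk
    refine ⟨by linarith, ?_⟩
    rw [hw, div_mul_eq_mul_div, le_div_iff₀ hδ]
    have h3 : s k - (σp - δ) ≤ s k - σ j := by linarith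
    have h4 : 48 / 47 * σp * (s k - (σp - δ)) ≤ 48 / 47 * σp * (s k - σ j) := by gcongr
    have h5 : 0 ≤ (48 / 47 * σp - δ) * (s k - (σp - δ / 48)) :=
      mul_nonneg (by linarith) (by linarith)
    nlinarith [sq_nonneg δ]
  set Z := frobNorm Pᶜ P' (fun j k => s k * inner ℝ (u j) (u' k)) with hZ
  set Z' := frobNorm Pᶜ P' (fun j k => s k * inner ℝ (v j) (v' k)) with hZ'
  set G := frobNorm Pᶜ P' (fun j k => inner ℝ (u j) (E (v' k))) with hG
  set H := frobNorm Pᶜ P' (fun j k => inner ℝ (v j) (ContinuousLinearMap.adjoint E (u' k)))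
    with hH
  have hG0 : 0 ≤ G := frobNorm_nonneg _ _ _
  have hH0 : 0 ≤ H := frobNorm_nonneg _ _ _
  have hZ1 : Z ≤ w * (G + H) := frobNorm_mul_inner_le_frobNorm_add hA hB hE hw0.le
    (fun j hj => (hσ j (by simpa using hj)).1) hgap
  have hZ2 : Z' ≤ w * (H + G) := by
    have := frobNorm_mul_inner_le_frobNorm_add hA.adjoint hB.adjoint hEadj hw0.le
      (fun j hj => (hσ j (by simpa using hj)).1) hgap
    rwa [ContinuousLinearMap.adjoint_adjoint] at this
  have hG1 : G ≤ r * (x * (1 + ε / s₀) + y / s₀ + ε ^ 3 / s₀ ^ 2) + ε ^ 2 / s₀ ^ 2 * Z := by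
    have := frobNorm_inner_perturbation_le hA hB hE (J := Pᶜ) hP' hs₀pos hs hx hy hxE hyE
    rwa [hr] at this
  have hH1 : H ≤ r * (x * (1 + ε / s₀) + y / s₀ + ε ^ 3 / s₀ ^ 2) + ε ^ 2 / s₀ ^ 2 * Z' := by
    have := frobNorm_inner_perturbation_le hA.adjoint hB.adjoint hEadj (J := Pᶜ) hP' hs₀pos hs
      hx hy (fun i j => by
        rw [ContinuousLinearMap.adjoint_inner_right, real_inner_comm]; exact hxE j i)
      (fun i j hij => by simpa only [ContinuousLinearMap.adjoint_adjoint] using hyE' i j hij)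
    rwa [hr, hnadj] at this
  obtain ⟨hb0, hwb⟩ := mul_add_le_of_coupled_bounds hr0 hδ hσp hε0 hx hy hs₀' hEσ hEδ hG0 hH0
    hZ1 hZ2 hG1 hH1
  set N := w * (G + H) + ε with hN
  have hmain := norm_svdPart_sub_le hA hB hcard hs₀pos hs hs' (N := N) (by positivity)
    (fun z => (norm_famResid_svdPart_le hA hB hE P P' z).trans (by
      refine mul_le_mul_of_nonneg_right ?_ (norm_nonneg _); linarith))
    (fun z => (norm_famResid_svdPart_le hA.adjoint hB.adjoint hEadj P P' z).trans (by
      rw [hnadj]; refine mul_le_mul_of_nonneg_right ?_ (norm_nonneg _); linarith))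
  have hBA : B - A = E := by rw [hE]; abel
  rw [hBA] at hmain
  have hq1 : 0 ≤ r * x * (σp / δ) := by positivity
  have hq2 : 0 ≤ r * y / δ := by positivity
  rw [← hε] at hmain
  linarith

end Truncation

/-! ### Transfer to matrices and their rank truncations. -/

section Matrices

variable {m n : ℕ}

/-- The operator between Euclidean spaces given by a matrix. -/
noncomputable def matCLM : Matrix (Fin m) (Fin n) ℝ ≃ₗ[ℝ]
    (EuclideanSpace ℝ (Fin n) →L[ℝ] EuclideanSpace ℝ (Fin m)) :=
  (Matrix.toEuclideanLin (𝕜 := ℝ) (m := Fin m) (n := Fin n)).trans LinearMap.toContinuousLinearMap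

theorem norm_matCLM (M : Matrix (Fin m) (Fin n) ℝ) : ‖matCLM M‖ = ‖M‖ := rfl

theorem matCLM_apply (M : Matrix (Fin m) (Fin n) ℝ) (x : EuclideanSpace ℝ (Fin n)) (i : Fin m) :
    matCLM M x i = ∑ j, M i j * x j := by
  simp [matCLM, Matrix.toLpLin_apply, Matrix.mulVec, dotProduct]

theorem adjoint_matCLM_apply (M : Matrix (Fin m) (Fin n) ℝ) (x : EuclideanSpace ℝ (Fin m))
    (j : Fin n) : ContinuousLinearMap.adjoint (matCLM M) x j = ∑ i, M i j * x i := by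
  have h := ContinuousLinearMap.adjoint_inner_right (matCLM M) (EuclideanSpace.single j 1) x
  rw [EuclideanSpace.inner_single_left] at h
  simp only [map_one, one_mul] at h
  rw [h, PiLp.inner_apply]
  refine Finset.sum_congr rfl fun i _ => ?_
  rw [matCLM_apply]
  simp [mul_comm]

theorem singVal_nonneg (M : Matrix (Fin m) (Fin n) ℝ) (k : ℕ) : 0 ≤ singVal M k :=
  LinearMap.singularValues_nonneg _ _

theorem singVal_le_of_le (M : Matrix (Fin m) (Fin n) ℝ) {k l : ℕ} (h : k ≤ l) :
    singVal M l ≤ singVal M k :=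
  LinearMap.singularValues_antitone _ (Nat.sub_le_sub_right h 1)

theorem le_rank_of_singVal_pos (M : Matrix (Fin m) (Fin n) ℝ) {k : ℕ} (h : 0 < singVal M k) :
    k ≤ M.rank := by
  rw [singVal, LinearMap.singularValues_pos_iff_lt_finrank_range,
    Matrix.toEuclideanLin_eq_toLin_orthonormal, ← Matrix.rank_eq_finrank_range_toLin] at h
  omega

theorem card_filter_succ_le (N q : ℕ) :
    (Finset.univ.filter (fun i : Fin N => (i : ℕ) + 1 ≤ q)).card = min N q := by
  simp only [Nat.succ_le_iff, Fin.card_filter_val_lt]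

/-- The indices of the `p` largest singular values. -/
def topIdx (N p : ℕ) : Finset (Fin N) := Finset.univ.filter (fun i : Fin N => (i : ℕ) + 1 ≤ p)

theorem mem_topIdx {N p : ℕ} {i : Fin N} : i ∈ topIdx N p ↔ (i : ℕ) + 1 ≤ p := by simp [topIdx]

theorem card_topIdx {N p : ℕ} (h : p ≤ N) : (topIdx N p).card = p := by
  rw [topIdx, card_filter_succ_le, min_eq_right h]

theorem matCLM_vecMulVec (x : EuclideanSpace ℝ (Fin m)) (y : EuclideanSpace ℝ (Fin n)) :
    matCLM (Matrix.vecMulVec x.ofLp y.ofLp) = (innerSL ℝ y).smulRight x := by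
  ext z i
  rw [matCLM_apply]
  simp [Matrix.vecMulVec_apply, PiLp.inner_apply, Finset.sum_mul]
  exact Finset.sum_congr rfl fun j _ => by ring

theorem IsRankTruncation.exists_isSVD {M B : Matrix (Fin m) (Fin n) ℝ} {p : ℕ}
    (h : IsRankTruncation M p B) :
    ∃ (u : Fin M.rank → EuclideanSpace ℝ (Fin m)) (v : Fin M.rank → EuclideanSpace ℝ (Fin n)),
      IsSVD (matCLM M) u v (fun i => singVal M (i + 1)) ∧
      matCLM B = svdPart (topIdx M.rank p) u v (fun i => singVal M (i + 1)) := by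
  obtain ⟨u, v, hu, hv, hM, hB⟩ := h
  have key : ∀ Q : Finset (Fin M.rank),
      matCLM (∑ i ∈ Q, singVal M (i + 1) • Matrix.vecMulVec (u i).ofLp (v i).ofLp) =
      svdPart Q u v (fun i => singVal M (i + 1)) := by
    intro Q
    rw [map_sum, svdPart]
    exact Finset.sum_congr rfl fun i _ => by rw [map_smul, matCLM_vecMulVec]
  refine ⟨u, v, ⟨hu, hv, fun x => ?_⟩, ?_⟩
  · rw [← svdPart_apply, ← key, ← hM]
  · rw [hB, key, topIdx]

/-- The singular system of A is fixed in advance, so that noise estimates for this one system apply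
to every truncation of A + E. -/
theorem norm_matCLM_sub_svdPart_le {A E Bp : Matrix (Fin m) (Fin n) ℝ} {p : ℕ} (hp : 1 ≤ p)
    (hpr : p ≤ A.rank) (hgap : 0 < singGap A p)
    {u : Fin A.rank → EuclideanSpace ℝ (Fin m)} {v : Fin A.rank → EuclideanSpace ℝ (Fin n)}
    (hA : IsSVD (matCLM A) u v (fun i => singVal A (i + 1)))
    (hB : IsRankTruncation (A + E) p Bp) {x y : ℝ} (hx : 0 ≤ x) (hy : 0 ≤ y)
    (hEσ : ‖E‖ ≤ singVal A p / 96)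
    (hEδ : A.rank * ‖E‖ ^ 2 ≤ singVal A p * singGap A p / 9216)
    (hxδ : A.rank * x ≤ singGap A p / 48)
    (hxE : ∀ i j, |inner ℝ (u i) (matCLM E (v j))| ≤ x)
    (hyE : ∀ i j, i ≠ j → |inner ℝ (ContinuousLinearMap.adjoint (matCLM E) (u i))
      (ContinuousLinearMap.adjoint (matCLM E) (u j))| ≤ y)
    (hyE' : ∀ i j, i ≠ j → |inner ℝ (matCLM E (v i)) (matCLM E (v j))| ≤ y) :
    ‖matCLM Bp - svdPart (topIdx A.rank p) u v (fun i => singVal A (i + 1))‖ ≤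
      5 * ‖E‖ + 7 * (A.rank * x * (singVal A p / singGap A p)) +
        7 * (A.rank * y / singGap A p) := by
  obtain ⟨u', v', hB', hBp⟩ := hB.exists_isSVD
  have hE : matCLM (A + E) = matCLM A + matCLM E := map_add _ _ _
  have hδσ : singGap A p ≤ singVal A p := by
    rw [singGap]; linarith [singVal_nonneg A (p + 1)]
  have hs₀ : singVal A p - singGap A p / 48 ≤ singVal (A + E) p := by
    -- The top p - 1 vectors of A + E are excluded, so the largest remaining singular value is at
    -- most the p-th.
    have h := sub_le_of_isSVD_add hA hB' hE (P := topIdx A.rank p)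
      (K₁ := topIdx (A + E).rank (p - 1)) (σp := singVal A p) (s₀ := singVal (A + E) p)
      (by
        rw [card_topIdx hpr, topIdx, card_filter_succ_le]
        exact (min_le_right _ _).trans_lt (by omega))
      (singVal_nonneg _ _) (fun i hi => singVal_le_of_le _ (mem_topIdx.1 hi))
      (fun k hk => ⟨singVal_nonneg _ _, singVal_le_of_le _ (by rw [mem_topIdx] at hk; omega)⟩)
      (singVal_nonneg _ _) hx hxE
    rw [card_topIdx hpr] at h
    have h2 : (p : ℝ) * x ≤ A.rank * x := by gcongr
    linarith
  have hpos : 0 < singVal (A + E) p := by linarith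
  -- Positivity of the p-th singular value gives A + E rank at least p, so both truncations have
  -- exactly p terms.
  have hrank := le_rank_of_singVal_pos _ hpos
  rw [hBp, ← norm_matCLM E]
  refine norm_svdPart_sub_svdPart_le hA hB' hE
    (by rw [card_topIdx hpr, card_topIdx hrank]) (Fintype.card_fin _) hgap hδσ
    (fun j hj => ⟨singVal_nonneg _ _, ?_⟩) hs₀ (fun k hk => singVal_le_of_le _ (mem_topIdx.1 hk))
    (fun k hk => ⟨singVal_nonneg _ _, singVal_le_of_le _ (by rw [mem_topIdx] at hk; omega)⟩)
    hx hy hEσ hEδ (hp.trans hpr) hxE hyE hyE'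
  rw [mem_topIdx] at hj
  rw [singGap, sub_sub_cancel]
  exact singVal_le_of_le _ (by omega)

/-- If there is a gap, the rank `p` truncation does not depend on the decomposition. -/
theorem IsRankTruncation.matCLM_eq {A Ap : Matrix (Fin m) (Fin n) ℝ} {p : ℕ} (hp : 1 ≤ p)
    (hpr : p ≤ A.rank) (hgap : 0 < singGap A p)
    {u : Fin A.rank → EuclideanSpace ℝ (Fin m)} {v : Fin A.rank → EuclideanSpace ℝ (Fin n)}
    (hA : IsSVD (matCLM A) u v (fun i => singVal A (i + 1))) (h : IsRankTruncation A p Ap) :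
    matCLM Ap = svdPart (topIdx A.rank p) u v (fun i => singVal A (i + 1)) := by
  -- The perturbation bound with E = 0 and x = y = 0 forces equality.
  have h' : IsRankTruncation (A + 0) p Ap := by rwa [add_zero]
  have hσ := singVal_nonneg A p
  have := norm_matCLM_sub_svdPart_le hp hpr hgap hA h' le_rfl le_rfl (by simp; positivity)
    (by simp; positivity) (by simp; positivity) (by simp) (by simp) (by simp)
  simpa [sub_eq_zero] using this

theorem norm_truncation_sub_le {A E Ap Bp : Matrix (Fin m) (Fin n) ℝ} {p : ℕ} (hp : 1 ≤ p)
    (hpr : p ≤ A.rank) (hgap : 0 < singGap A p)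
    {u : Fin A.rank → EuclideanSpace ℝ (Fin m)} {v : Fin A.rank → EuclideanSpace ℝ (Fin n)}
    (hA : IsSVD (matCLM A) u v (fun i => singVal A (i + 1))) (hAp : IsRankTruncation A p Ap)
    (hB : IsRankTruncation (A + E) p Bp) {x y : ℝ} (hx : 0 ≤ x) (hy : 0 ≤ y)
    (hEσ : ‖E‖ ≤ singVal A p / 96)
    (hEδ : A.rank * ‖E‖ ^ 2 ≤ singVal A p * singGap A p / 9216)
    (hxδ : A.rank * x ≤ singGap A p / 48)
    (hxE : ∀ i j, |inner ℝ (u i) (matCLM E (v j))| ≤ x)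
    (hyE : ∀ i j, i ≠ j → |inner ℝ (ContinuousLinearMap.adjoint (matCLM E) (u i))
      (ContinuousLinearMap.adjoint (matCLM E) (u j))| ≤ y)
    (hyE' : ∀ i j, i ≠ j → |inner ℝ (matCLM E (v i)) (matCLM E (v j))| ≤ y) :
    ‖Bp - Ap‖ ≤ 5 * ‖E‖ + 7 * (A.rank * x * (singVal A p / singGap A p)) +
        7 * (A.rank * y / singGap A p) := by
  rw [← norm_matCLM, map_sub, hAp.matCLM_eq hp hpr hgap hA]
  exact norm_matCLM_sub_svdPart_le hp hpr hgap hA hB hx hy hEσ hEδ hxδ hxE hyE hyE'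

theorem CondC0.bounds {A E : Matrix (Fin m) (Fin n) ℝ} {p : ℕ} {t : ℝ} (hp : 1 ≤ p)
    (hpr : p ≤ A.rank) (ht : 0 < t) (hgap : 0 < singGap A p) (h : CondC0 A E p t) :
    ‖E‖ ≤ singVal A p / 96 ∧ A.rank * ‖E‖ ^ 2 ≤ singVal A p * singGap A p / 9216 ∧
      A.rank * (2 * t) ≤ singGap A p / 48 := by
  have hσ : 0 < singVal A p := by
    have := singVal_nonneg A (p + 1)
    rw [singGap] at hgap; linarith
  have hp1 : (1 : ℝ) ≤ p := by exact_mod_cast hp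
  have hr1 : (1 : ℝ) ≤ A.rank := by exact_mod_cast hp.trans hpr
  obtain ⟨h12, h3⟩ := max_le_iff.1 h
  obtain ⟨h1, h2⟩ := max_le_iff.1 h12
  refine ⟨?_, ?_, ?_⟩
  · have : ‖E‖ / singVal A p ≤ 1 / 96 :=
      (le_mul_of_one_le_left (by positivity) hp1).trans h1
    rw [div_le_iff₀ hσ] at this
    linarith
  · rw [Real.sqrt_le_left (by norm_num), mul_div_assoc', div_le_iff₀ (by positivity)] at h3
    linarith
  · rw [mul_one_div, div_le_iff₀ hgap] at h2
    have : A.rank * t ≤ (A.rank : ℝ) ^ 2 * t := by gcongr; nlinarith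
    linarith

end Matrices

/-! ### Exponential and second moment estimates for independent variables. -/

section Probability

variable {Ω I : Type*} [MeasurableSpace Ω] [Fintype I] {μ : Measure Ω} [IsProbabilityMeasure μ]
  {X : I → Ω → ℝ} {K : ℝ}

/-- Markov's inequality for the exponential, taken at parameter 1: scaling and nonlinearity are put
into `g`, which serves both linear and quadratic sums. -/
theorem measureReal_sum_ge_le_exp (hX : iIndepFun X μ) (hm : ∀ i, AEMeasurable (X i) μ)
    {g : I → ℝ → ℝ} (hg : ∀ i, Continuous (g i)) {C : ℝ}
    (hC : ∀ i, ∀ᵐ ω ∂μ, |g i (X i ω)| ≤ C) {b : I → ℝ}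
    (hb : ∀ i, ∫ ω, Real.exp (g i (X i ω)) ∂μ ≤ Real.exp (b i)) (L : ℝ) :
    μ.real {ω | L + ∑ i, b i ≤ ∑ i, g i (X i ω)} ≤ Real.exp (-L) := by
  have hgm : ∀ i, AEMeasurable (fun ω => g i (X i ω)) μ := fun i =>
    (hg i).measurable.comp_aemeasurable (hm i)
  have hint : Integrable (fun ω => Real.exp (1 * ∑ i, g i (X i ω))) μ := by
    refine Integrable.of_bound (C := Real.exp (∑ _i : I, C)) ?_ ?_
    · exact (Real.measurable_exp.comp_aemeasurable
        ((Finset.aemeasurable_fun_sum _ fun i _ => hgm i).const_mul 1)).aestronglyMeasurable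
    · filter_upwards [ae_all_iff.2 hC] with ω hω
      rw [Real.norm_eq_abs, Real.abs_exp, Real.exp_le_exp, one_mul]
      exact Finset.sum_le_sum fun i _ => (le_abs_self _).trans (hω i)
  refine (measure_ge_le_exp_mul_mgf (L + ∑ i, b i) zero_le_one hint).trans ?_
  have hmgf : mgf (fun ω => ∑ i, g i (X i ω)) μ 1 ≤ Real.exp (∑ i, b i) := by
    have h1 : mgf (fun ω => ∑ i, g i (X i ω)) μ 1 = ∏ i, ∫ ω, Real.exp (g i (X i ω)) ∂μ := by
      rw [mgf, ← hX.integral_fun_prod_comp (f := fun i x => Real.exp (g i x)) hm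
        (fun i => (Real.continuous_exp.comp (hg i)).aestronglyMeasurable)]
      simp [Real.exp_sum]
    rw [h1, Real.exp_sum]
    exact Finset.prod_le_prod (fun i _ => integral_nonneg fun ω => (Real.exp_pos _).le)
      fun i _ => hb i
  calc _ ≤ Real.exp (-1 * (L + ∑ i, b i)) * Real.exp (∑ i, b i) := by gcongr
    _ = Real.exp (-L) := by rw [← Real.exp_add]; congr 1; ring

theorem exp_le_one_add_add_sq {x : ℝ} (hx : |x| ≤ 1) : Real.exp x ≤ 1 + x + x ^ 2 := by
  have := (abs_le.1 (Real.abs_exp_sub_one_sub_id_le hx)).2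
  linarith

theorem integrable_of_abs_le {Y : Ω → ℝ} (hm : AEMeasurable Y μ)
    (hK : ∀ᵐ ω ∂μ, |Y ω| ≤ K) : Integrable Y μ :=
  Integrable.of_bound hm.aestronglyMeasurable K hK

theorem integrable_pow_of_abs_le {Y : Ω → ℝ} (hm : AEMeasurable Y μ)
    (hK : ∀ᵐ ω ∂μ, |Y ω| ≤ K) (e : ℕ) : Integrable (fun ω => Y ω ^ e) μ := by
  refine integrable_of_abs_le (K := K ^ e) (hm.pow_const e) ?_
  filter_upwards [hK] with ω hω
  rw [abs_pow]
  exact pow_le_pow_left₀ (abs_nonneg _) hω e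

theorem integral_exp_mul_le {Y : Ω → ℝ} (hm : AEMeasurable Y μ) (hK : ∀ᵐ ω ∂μ, |Y ω| ≤ K)
    (h1 : ∫ ω, Y ω ∂μ = 0) (h2 : ∫ ω, Y ω ^ 2 ∂μ = 1) {a : ℝ} (ha : |a| * K ≤ 1) :
    ∫ ω, Real.exp (a * Y ω) ∂μ ≤ Real.exp (a ^ 2) := by
  have hi1 := integrable_of_abs_le hm hK
  have hi2 := integrable_pow_of_abs_le hm hK 2
  calc ∫ ω, Real.exp (a * Y ω) ∂μ ≤ ∫ ω, (1 + a * Y ω + a ^ 2 * Y ω ^ 2) ∂μ := by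
        refine integral_mono_of_nonneg (Filter.Eventually.of_forall fun ω => (Real.exp_pos _).le)
          (((integrable_const 1).add (hi1.const_mul a)).add (hi2.const_mul (a ^ 2))) ?_
        filter_upwards [hK] with ω hω
        have := exp_le_one_add_add_sq (x := a * Y ω) (by
          rw [abs_mul]; exact (mul_le_mul_of_nonneg_left hω (abs_nonneg a)).trans ha)
        rwa [mul_pow] at this
    _ = 1 + a ^ 2 := by
        have hi : Integrable (fun ω => 1 + a * Y ω) μ := (integrable_const 1).add (hi1.const_mul a)
        rw [integral_add hi (hi2.const_mul (a ^ 2)),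
          integral_add (integrable_const 1) (hi1.const_mul a), integral_const_mul,
          integral_const_mul, h1, h2]
        simp
    _ ≤ Real.exp (a ^ 2) := by linarith [Real.add_one_le_exp (a ^ 2)]

theorem integral_exp_mul_sq_le {Y : Ω → ℝ} (hm : AEMeasurable Y μ) (hK : ∀ᵐ ω ∂μ, |Y ω| ≤ K)
    (h2 : ∫ ω, Y ω ^ 2 ∂μ = 1) {a : ℝ} (ha : |a| * K ^ 2 ≤ 1) :
    ∫ ω, Real.exp (a * Y ω ^ 2) ∂μ ≤ Real.exp (a + a ^ 2 * K ^ 2) := by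
  have hi2 := integrable_pow_of_abs_le hm hK 2
  have hsq : ∀ᵐ ω ∂μ, Y ω ^ 2 ≤ K ^ 2 := by
    filter_upwards [hK] with ω hω
    rw [← sq_abs]
    exact pow_le_pow_left₀ (abs_nonneg _) hω 2
  calc ∫ ω, Real.exp (a * Y ω ^ 2) ∂μ ≤ ∫ ω, (1 + (a + a ^ 2 * K ^ 2) * Y ω ^ 2) ∂μ := by
        refine integral_mono_of_nonneg (Filter.Eventually.of_forall fun ω => (Real.exp_pos _).le)
          ((integrable_const 1).add (hi2.const_mul _)) ?_
        filter_upwards [hsq] with ω hω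
        have h3 := exp_le_one_add_add_sq (x := a * Y ω ^ 2) (by
          rw [abs_mul, abs_of_nonneg (sq_nonneg (Y ω))]
          exact (mul_le_mul_of_nonneg_left hω (abs_nonneg a)).trans ha)
        have h4 : a ^ 2 * Y ω ^ 2 * Y ω ^ 2 ≤ a ^ 2 * Y ω ^ 2 * K ^ 2 := by gcongr
        have h5 : (a * Y ω ^ 2) ^ 2 = a ^ 2 * Y ω ^ 2 * Y ω ^ 2 := by ring
        linarith
    _ = 1 + (a + a ^ 2 * K ^ 2) := by
        rw [integral_add (integrable_const 1) (hi2.const_mul _), integral_const_mul, h2]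
        simp
    _ ≤ _ := by linarith [Real.add_one_le_exp (a + a ^ 2 * K ^ 2)]

theorem measureReal_linear_ge_le (hX : iIndepFun X μ) (hm : ∀ i, AEMeasurable (X i) μ)
    (hK : ∀ i, ∀ᵐ ω ∂μ, |X i ω| ≤ K) (hK0 : 0 ≤ K) (h1 : ∀ i, ∫ ω, X i ω ∂μ = 0)
    (h2 : ∀ i, ∫ ω, X i ω ^ 2 ∂μ = 1) {c : I → ℝ} (hc : ∑ i, c i ^ 2 ≤ 1) {l : ℝ} (hl : 0 < l)
    (hlK : l * K ≤ 1) (s : ℝ) :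
    μ.real {ω | s ≤ ∑ i, c i * X i ω} ≤ Real.exp (-(l * s) + l ^ 2) := by
  have hci : ∀ i, |c i| ≤ 1 := fun i => by
    rw [← sq_le_one_iff_abs_le_one]
    exact (Finset.single_le_sum (fun j _ => sq_nonneg (c j)) (Finset.mem_univ i)).trans hc
  have hlc : ∀ i, |l * c i| ≤ l := fun i => by
    rw [abs_mul, abs_of_pos hl]; exact mul_le_of_le_one_right hl.le (hci i)
  have hbase : ∀ i, |l * c i| * K ≤ 1 := fun i =>
    (mul_le_mul_of_nonneg_right (hlc i) hK0).trans hlK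
  have h := measureReal_sum_ge_le_exp hX hm (g := fun i x => l * c i * x) (C := 1)
    (fun i => by fun_prop)
    (fun i => by
      filter_upwards [hK i] with ω hω
      rw [abs_mul]
      exact (mul_le_mul_of_nonneg_left hω (abs_nonneg _)).trans (hbase i))
    (b := fun i => (l * c i) ^ 2)
    (fun i => integral_exp_mul_le (hm i) (hK i) (h1 i) (h2 i) (hbase i)) (l * s - l ^ 2)
  have hb : ∑ i, (l * c i) ^ 2 ≤ l ^ 2 := by
    simp_rw [mul_pow]
    rw [← Finset.mul_sum]
    exact mul_le_of_le_one_right (sq_nonneg l) hc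
  refine (measureReal_mono ?_).trans (h.trans_eq (by congr 1; ring))
  intro ω hω
  simp only [Set.mem_ofPred_eq] at hω ⊢
  have : l * s ≤ l * ∑ i, c i * X i ω := by gcongr
  rw [Finset.mul_sum] at this
  simp_rw [← mul_assoc] at this
  linarith

/-- Subtracting 2(l c)²K² X² compensates the second-order term of the exponential moment: each
factor has mean at most exp(l c_i), and these exponents sum to zero. The compensator is thus a
random quantity, to be bounded later by ‖E‖, instead of a fourth-moment sum. -/
theorem measureReal_sq_ge_le (hX : iIndepFun X μ) (hm : ∀ i, AEMeasurable (X i) μ)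
    (hK : ∀ i, ∀ᵐ ω ∂μ, |X i ω| ≤ K) (h2 : ∀ i, ∫ ω, X i ω ^ 2 ∂μ = 1) {c : I → ℝ}
    (hc : ∑ i, c i = 0) {l : ℝ} (hlK : ∀ i, |l * c i| * K ^ 2 ≤ 1 / 8) (L : ℝ) :
    μ.real {ω | L ≤ ∑ i, (l * c i - 2 * (l * c i) ^ 2 * K ^ 2) * X i ω ^ 2} ≤
      Real.exp (-L) := by
  have hbd : ∀ i, |l * c i - 2 * (l * c i) ^ 2 * K ^ 2| ≤ 5 / 4 * |l * c i| := fun i => by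
    have h3 : 2 * (l * c i) ^ 2 * K ^ 2 ≤ 1 / 4 * |l * c i| := by
      rw [← sq_abs (l * c i)]
      nlinarith [hlK i, abs_nonneg (l * c i)]
    refine (abs_sub _ _).trans ?_
    rw [abs_of_nonneg (a := 2 * (l * c i) ^ 2 * K ^ 2) (by positivity)]
    linarith
  have hbase : ∀ i, |l * c i - 2 * (l * c i) ^ 2 * K ^ 2| * K ^ 2 ≤ 1 := fun i => by
    have := mul_le_mul_of_nonneg_right (hbd i) (sq_nonneg K)
    have := hlK i
    linarith
  have h := measureReal_sum_ge_le_exp hX hm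
    (g := fun i x => (l * c i - 2 * (l * c i) ^ 2 * K ^ 2) * x ^ 2) (C := 1)
    (fun i => by fun_prop)
    (fun i => by
      filter_upwards [hK i] with ω hω
      rw [abs_mul, abs_pow]
      exact (mul_le_mul_of_nonneg_left (pow_le_pow_left₀ (abs_nonneg _) hω 2)
        (abs_nonneg _)).trans (hbase i))
    (b := fun i => l * c i)
    (fun i => (integral_exp_mul_sq_le (hm i) (hK i) (h2 i) (hbase i)).trans (by
      rw [Real.exp_le_exp]
      have h3 : (l * c i - 2 * (l * c i) ^ 2 * K ^ 2) ^ 2 ≤ 2 * (l * c i) ^ 2 := by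
        rw [← sq_abs]
        calc _ ≤ (5 / 4 * |l * c i|) ^ 2 := pow_le_pow_left₀ (abs_nonneg _) (hbd i) 2
          _ = 25 / 16 * (l * c i) ^ 2 := by rw [mul_pow, sq_abs]; norm_num
          _ ≤ _ := by nlinarith [sq_nonneg (l * c i)]
      nlinarith [mul_le_mul_of_nonneg_right h3 (sq_nonneg K)])) L
  rwa [← Finset.mul_sum, hc, mul_zero, add_zero] at h

/-- By independence the integral is a product of moments with exponents the multiplicities `e`. An
index of multiplicity one gives zero, so only the two pairings of {a, b} with {c, d} survive. -/
theorem integral_mul_four (hX : iIndepFun X μ) (hm : ∀ i, AEMeasurable (X i) μ)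
    (h1 : ∀ i, ∫ ω, X i ω ∂μ = 0) (h2 : ∀ i, ∫ ω, X i ω ^ 2 ∂μ = 1) [DecidableEq I]
    {a b c d : I} (hab : a ≠ b) (hcd : c ≠ d) :
    ∫ ω, X a ω * X b ω * (X c ω * X d ω) ∂μ =
      (if c = a ∧ d = b then 1 else 0) + (if c = b ∧ d = a then 1 else 0) := by
  let e : I → ℕ := fun i => (if a = i then 1 else 0) + (if b = i then 1 else 0) +
    ((if c = i then 1 else 0) + (if d = i then 1 else 0))
  have h3 : ∫ ω, X a ω * X b ω * (X c ω * X d ω) ∂μ = ∏ i, ∫ ω, X i ω ^ e i ∂μ := by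
    rw [← hX.integral_fun_prod_comp (f := fun i x => x ^ e i) hm
      (fun i => (continuous_pow (e i)).aestronglyMeasurable)]
    congr 1
    ext ω
    simp only [e, pow_add, Finset.prod_mul_distrib, Finset.prod_pow_boole, Finset.mem_univ, if_true]
  have hzero : ∀ i, e i = 1 → ∏ i, ∫ ω, X i ω ^ e i ∂μ = 0 := fun i hi =>
    Finset.prod_eq_zero (Finset.mem_univ i) (by simp [hi, h1])
  rw [h3]
  by_cases hm1 : c = a ∧ d = b
  · obtain ⟨rfl, rfl⟩ := hm1
    rw [if_pos ⟨rfl, rfl⟩, if_neg (fun h => hab h.1), add_zero]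
    refine Finset.prod_eq_one fun i _ => ?_
    have : e i = 0 ∨ e i = 2 := by simp only [e]; grind
    rcases this with h | h <;> simp [h, h2]
  by_cases hm2 : c = b ∧ d = a
  · obtain ⟨rfl, rfl⟩ := hm2
    rw [if_neg hm1, if_pos ⟨rfl, rfl⟩, zero_add]
    refine Finset.prod_eq_one fun i _ => ?_
    have : e i = 0 ∨ e i = 2 := by simp only [e]; grind
    rcases this with h | h <;> simp [h, h2]
  rw [if_neg hm1, if_neg hm2, add_zero]
  by_cases hca : c = a
  · refine hzero d ?_
    simp only [e]; grind
  by_cases hcb : c = b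
  · refine hzero d ?_
    simp only [e]; grind
  · refine hzero c ?_
    simp only [e]; grind

theorem integral_sq_offDiag_le (hX : iIndepFun X μ) (hm : ∀ i, AEMeasurable (X i) μ)
    (hK : ∀ i, ∀ᵐ ω ∂μ, |X i ω| ≤ K) (hK0 : 0 ≤ K)
    (h1 : ∀ i, ∫ ω, X i ω ∂μ = 0) (h2 : ∀ i, ∫ ω, X i ω ^ 2 ∂μ = 1)
    {c : I → I → ℝ} (hc : ∀ i, c i i = 0) :
    Integrable (fun ω => (∑ a, ∑ b, c a b * (X a ω * X b ω)) ^ 2) μ ∧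
    ∫ ω, (∑ a, ∑ b, c a b * (X a ω * X b ω)) ^ 2 ∂μ ≤ 2 * ∑ a, ∑ b, c a b ^ 2 := by
  classical
  have hint : ∀ a b a' b', Integrable (fun ω => c a b * c a' b' *
      (X a ω * X b ω * (X a' ω * X b' ω))) μ := by
    intro a b a' b'
    refine (integrable_of_abs_le (K := K * K * (K * K))
      (((hm a).mul (hm b)).mul ((hm a').mul (hm b'))) ?_).const_mul _
    filter_upwards [hK a, hK b, hK a', hK b'] with ω ha hb ha' hb'
    simp only [Pi.mul_apply, abs_mul]
    gcongr
  have hexp : (fun ω => (∑ a, ∑ b, c a b * (X a ω * X b ω)) ^ 2) = fun ω =>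
      ∑ a, ∑ b, ∑ a', ∑ b', c a b * c a' b' * (X a ω * X b ω * (X a' ω * X b' ω)) := by
    ext ω
    rw [sq, Finset.sum_mul]
    refine Finset.sum_congr rfl fun a _ => ?_
    rw [Finset.sum_mul]
    refine Finset.sum_congr rfl fun b _ => ?_
    rw [Finset.mul_sum]
    refine Finset.sum_congr rfl fun a' _ => ?_
    rw [Finset.mul_sum]
    exact Finset.sum_congr rfl fun b' _ => by ring
  have hi4 : ∀ a b a', Integrable (fun ω => ∑ b', c a b * c a' b' *
      (X a ω * X b ω * (X a' ω * X b' ω))) μ := fun a b a' =>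
    integrable_finsetSum _ fun b' _ => hint a b a' b'
  have hi3 : ∀ a b, Integrable (fun ω => ∑ a', ∑ b', c a b * c a' b' *
      (X a ω * X b ω * (X a' ω * X b' ω))) μ := fun a b =>
    integrable_finsetSum _ fun a' _ => hi4 a b a'
  have hi2 : ∀ a, Integrable (fun ω => ∑ b, ∑ a', ∑ b', c a b * c a' b' *
      (X a ω * X b ω * (X a' ω * X b' ω))) μ := fun a =>
    integrable_finsetSum _ fun b _ => hi3 a b
  rw [hexp]
  refine ⟨integrable_finsetSum _ fun a _ => hi2 a, ?_⟩
  have hval : ∀ a b, ∫ ω, ∑ a', ∑ b', c a b * c a' b' * (X a ω * X b ω * (X a' ω * X b' ω)) ∂μ =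
      c a b * (c a b + c b a) := by
    intro a b
    by_cases hab : a = b
    · subst hab; simp [hc]
    have hterm : ∀ a' b', ∫ ω, c a b * c a' b' * (X a ω * X b ω * (X a' ω * X b' ω)) ∂μ =
        c a b * ((if a' = a then if b' = b then c a' b' else 0 else 0) +
          (if a' = b then if b' = a then c a' b' else 0 else 0)) := by
      intro a' b'
      rw [integral_const_mul]
      by_cases hcd : a' = b'
      · subst hcd; simp [hc]
      rw [integral_mul_four hX hm h1 h2 hab hcd]
      grind
    rw [integral_finsetSum _ fun a' _ => hi4 a b a']
    simp_rw [integral_finsetSum _ fun b' _ => hint a b _ b', hterm]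
    simp [← Finset.mul_sum, Finset.sum_add_distrib]
  rw [integral_finsetSum _ fun a _ => hi2 a]
  simp_rw [integral_finsetSum _ fun b _ => hi3 _ b, hval]
  -- The two pairings contribute c_ab² and c_ab c_ba; AM–GM on the latter gives the factor 2.
  have h3 : ∑ a, ∑ b, c a b * (c a b + c b a) ≤
      ∑ a, ∑ b, (c a b ^ 2 + (c a b ^ 2 + c b a ^ 2) / 2) :=
    Finset.sum_le_sum fun a _ => Finset.sum_le_sum fun b _ => by
      nlinarith [sq_nonneg (c a b - c b a)]
  refine h3.trans_eq ?_
  have h4 : ∑ a, ∑ b, c b a ^ 2 = ∑ a, ∑ b, c a b ^ 2 := Finset.sum_comm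
  simp_rw [Finset.sum_add_distrib, ← Finset.sum_div, Finset.sum_add_distrib, h4]
  ring

theorem measureReal_offDiag_ge_le (hX : iIndepFun X μ) (hm : ∀ i, AEMeasurable (X i) μ)
    (hK : ∀ i, ∀ᵐ ω ∂μ, |X i ω| ≤ K) (hK0 : 0 ≤ K)
    (h1 : ∀ i, ∫ ω, X i ω ∂μ = 0) (h2 : ∀ i, ∫ ω, X i ω ^ 2 ∂μ = 1)
    {c : I → I → ℝ} (hc : ∀ i, c i i = 0) {t : ℝ} (ht : 0 < t) :
    μ.real {ω | t ≤ |∑ a, ∑ b, c a b * (X a ω * X b ω)|} ≤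
      2 * (∑ a, ∑ b, c a b ^ 2) / t ^ 2 := by
  obtain ⟨hi, hle⟩ := integral_sq_offDiag_le hX hm hK hK0 h1 h2 hc
  have h := mul_meas_ge_le_integral_of_nonneg
    (Filter.Eventually.of_forall fun ω => sq_nonneg _) hi (t ^ 2)
  rw [le_div_iff₀ (by positivity), mul_comm]
  refine le_trans (mul_le_mul_of_nonneg_left (measureReal_mono (fun ω hω => ?_)) (sq_nonneg t))
    (h.trans hle)
  simp only [Set.mem_ofPred_eq] at hω ⊢
  rw [← sq_abs (∑ a, _)]
  exact pow_le_pow_left₀ ht.le hω 2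

end Probability

/-! ### Tails of linear and quadratic forms of the noise. -/

section Tails

variable {Ω : Type*} [MeasurableSpace Ω] {μ : Measure Ω} [IsProbabilityMeasure μ] {K : ℝ}

theorem measureReal_abs_linear_ge_le {I : Type*} [Fintype I] {X : I → Ω → ℝ}
    (hX : iIndepFun X μ) (hm : ∀ i, AEMeasurable (X i) μ)
    (hK : ∀ i, ∀ᵐ ω ∂μ, |X i ω| ≤ K) (hK0 : 0 ≤ K) (h1 : ∀ i, ∫ ω, X i ω ∂μ = 0)
    (h2 : ∀ i, ∫ ω, X i ω ^ 2 ∂μ = 1) {c : I → ℝ} (hc : ∑ i, c i ^ 2 ≤ 1) {t : ℝ} (ht : 0 < t) :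
    μ.real {ω | 2 * t ≤ |∑ i, c i * X i ω|} ≤
      2 * Real.exp (-(3 * (t ^ 2 / 2 / (4 + K * t)))) := by
  have hKt : 0 ≤ K * t := by positivity
  -- This l satisfies l ≤ t/2 and lK ≤ 1. At threshold 2t the exponent is at least 3lt/2, hence at
  -- least three times t²/2 / (4 + Kt); this surplus later pays for the prefactors.
  set l := t / (2 + K * t) with hl
  have hl0 : 0 < l := by positivity
  have hlK : l * K ≤ 1 := by
    rw [hl, div_mul_eq_mul_div, div_le_one (by positivity)]; linarith
  have hexp : Real.exp (-(l * (2 * t)) + l ^ 2) ≤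
      Real.exp (-(3 * (t ^ 2 / 2 / (4 + K * t)))) := by
    rw [Real.exp_le_exp]
    have e1 : l ^ 2 ≤ l * t / 2 := by
      rw [sq, mul_div_assoc]
      gcongr
      rw [hl]
      gcongr
      linarith
    have e2 : t ^ 2 / 2 / (4 + K * t) ≤ l * t / 2 := by
      rw [hl, div_mul_eq_mul_div, ← sq, div_right_comm]
      gcongr
      linarith
    linarith
  have hp := (measureReal_linear_ge_le hX hm hK hK0 h1 h2 hc hl0 hlK (2 * t)).trans hexp
  have hn := (measureReal_linear_ge_le hX hm hK hK0 h1 h2 (c := fun i => -c i)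
    (by simpa using hc) hl0 hlK (2 * t)).trans hexp
  have hsub : {ω | 2 * t ≤ |∑ i, c i * X i ω|} ⊆
      {ω | 2 * t ≤ ∑ i, c i * X i ω} ∪ {ω | 2 * t ≤ ∑ i, -c i * X i ω} := by
    intro ω hω
    simp only [Set.mem_ofPred_eq, Set.mem_union, neg_mul, Finset.sum_neg_distrib] at hω ⊢
    exact le_abs.1 hω
  calc _ ≤ _ := measureReal_mono hsub
    _ ≤ _ := measureReal_union_le _ _
    _ ≤ _ := by linarith

variable {ι κ : Type*} [Fintype ι] [Fintype κ]

theorem sum_mul_sum_eq_diag_add_offDiag [DecidableEq ι] [DecidableEq κ] (u w : ι → ℝ)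
    (x : ι → κ → ℝ) :
    ∑ k, (∑ a, u a * x a k) * (∑ b, w b * x b k) = ∑ q : ι × κ, u q.1 * w q.1 * x q.1 q.2 ^ 2 +
      ∑ q : ι × κ, ∑ q' : ι × κ, (if q.2 = q'.2 ∧ q.1 ≠ q'.1 then u q.1 * w q'.1 else 0) *
        (x q.1 q.2 * x q'.1 q'.2) := by
  simp_rw [Fintype.sum_prod_type]
  rw [← Finset.sum_add_distrib, Finset.sum_congr rfl (fun k _ => Finset.sum_mul _ _ _),
    Finset.sum_comm]
  refine Finset.sum_congr rfl fun a _ => ?_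
  rw [← Finset.sum_add_distrib]
  refine Finset.sum_congr rfl fun k _ => ?_
  rw [Finset.mul_sum, ← Finset.add_sum_erase _ _ (Finset.mem_univ a)]
  congr 1
  · ring
  · rw [← Finset.add_sum_erase (a := a) _ _ (Finset.mem_univ a)]
    simp only [ne_eq, not_true_eq_false, and_false, if_false, zero_mul, Finset.sum_const_zero,
      zero_add]
    refine Finset.sum_congr rfl fun b hb => ?_
    rw [Finset.sum_eq_single k]
    · rw [if_pos ⟨rfl, (Finset.ne_of_mem_erase hb).symm⟩]; ring
    · intro k' _ hk'
      rw [if_neg (fun h => hk' h.1.symm), zero_mul]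
    · simp

theorem sum_offDiag_sq_le [DecidableEq ι] [DecidableEq κ] {u w : ι → ℝ} (hu : ∑ a, u a ^ 2 = 1)
    (hw : ∑ a, w a ^ 2 = 1) :
    ∑ q : ι × κ, ∑ q' : ι × κ, (if q.2 = q'.2 ∧ q.1 ≠ q'.1 then u q.1 * w q'.1 else 0) ^ 2 ≤
      (Fintype.card κ : ℝ) := by
  calc _ ≤ ∑ q : ι × κ, ∑ q' : ι × κ, (if q.2 = q'.2 then u q.1 ^ 2 * w q'.1 ^ 2 else 0) := by
        refine Finset.sum_le_sum fun q _ => Finset.sum_le_sum fun q' _ => ?_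
        by_cases h : q.2 = q'.2 <;> by_cases h' : q.1 = q'.1 <;> simp [h, h', mul_pow]
        positivity
    _ = _ := by
        simp_rw [Fintype.sum_prod_type]
        simp [← Finset.mul_sum, hu, hw]

/-- The off-diagonal part is centred with variance of order |κ|, so Chebyshev suffices. The diagonal
coefficients u_a w_a sum to zero over the whole array by orthogonality, so the compensated Chernoff
bound applies. Row norms at most ε ≤ σ/96 bound the compensator. The exceptional set is chosen
before ε, which may therefore be ‖E ω‖. -/
theorem exists_quadratic_tail {X : ι × κ → Ω → ℝ} (hX : iIndepFun X μ)
    (hm : ∀ i, AEMeasurable (X i) μ) (hK : ∀ i, ∀ᵐ ω ∂μ, |X i ω| ≤ K) (hK0 : 0 < K)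
    (h1 : ∀ i, ∫ ω, X i ω ∂μ = 0) (h2 : ∀ i, ∫ ω, X i ω ^ 2 ∂μ = 1) {u w : ι → ℝ}
    (hu : ∑ a, u a ^ 2 = 1) (hw : ∑ a, w a ^ 2 = 1) (huw : ∑ a, u a * w a = 0)
    {t₁ t₂ σ L : ℝ} (ht₂ : 0 < t₂) (hKt : K ≤ t₁) (hσ : 0 < σ) (hL : K * L ≤ 3 / 2 * t₁) :
    ∃ S : Set Ω, μ.real S ≤ 2 * Real.exp (-L) + 2 * Fintype.card κ / t₂ ^ 2 ∧
      ∀ ω ∉ S, ∀ ε, ε ≤ σ / 96 → 0 ≤ ε → (∀ a, ∑ k, X (a, k) ω ^ 2 ≤ ε ^ 2) →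
        |∑ k, (∑ a, u a * X (a, k) ω) * (∑ b, w b * X (b, k) ω)| ≤ t₂ + t₁ * σ := by
  classical
  have hu1 : ∀ a, |u a| ≤ 1 := fun a => by
    rw [← sq_le_one_iff_abs_le_one, ← hu]
    exact Finset.single_le_sum (fun j _ => sq_nonneg (u j)) (Finset.mem_univ a)
  have hw1 : ∀ a, |w a| ≤ 1 := fun a => by
    rw [← sq_le_one_iff_abs_le_one, ← hw]
    exact Finset.single_le_sum (fun j _ => sq_nonneg (w j)) (Finset.mem_univ a)
  let c : ι × κ → ℝ := fun q => u q.1 * w q.1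
  have hc1 : ∀ q, |c q| ≤ 1 := fun q => by
    rw [abs_mul]; exact mul_le_one₀ (hu1 _) (abs_nonneg _) (hw1 _)
  have hc0 : ∑ q, c q = 0 := by
    rw [Fintype.sum_prod_type]
    simp [c, ← Finset.mul_sum, huw]
  let D : Ω → ℝ := fun ω => ∑ q, c q * X q ω ^ 2
  suffices hD : ∃ S : Set Ω, μ.real S ≤ 2 * Real.exp (-L) ∧
      ∀ ω ∉ S, ∀ ε, ε ≤ σ / 96 → 0 ≤ ε → (∀ a, ∑ k, X (a, k) ω ^ 2 ≤ ε ^ 2) →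
        |D ω| ≤ t₁ * σ by
    obtain ⟨S, hS, hS'⟩ := hD
    have hO := measureReal_offDiag_ge_le hX hm hK hK0.le h1 h2
      (c := fun q q' => if q.2 = q'.2 ∧ q.1 ≠ q'.1 then u q.1 * w q'.1 else 0) (by simp) ht₂
    refine ⟨S ∪ _, (measureReal_union_le _ _).trans (add_le_add hS (hO.trans ?_)), ?_⟩
    · gcongr
      exact sum_offDiag_sq_le hu hw
    · intro ω hω ε h3 h4 h5
      simp only [Set.mem_union, not_or, Set.mem_ofPred_eq, not_le] at hω
      rw [sum_mul_sum_eq_diag_add_offDiag u w (fun a k => X (a, k) ω), add_comm t₂]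
      exact (abs_add_le _ _).trans (add_le_add (hS' ω hω.1 ε h3 h4 h5) hω.2.le)
  have hrow : ∀ (f : ι → ℝ), (∀ a, 0 ≤ f a) → ∑ a, f a ≤ 1 → ∀ ω, ∀ ε : ℝ,
      (∀ a, ∑ k, X (a, k) ω ^ 2 ≤ ε ^ 2) → ∑ q : ι × κ, f q.1 * X q ω ^ 2 ≤ ε ^ 2 := by
    intro f hf0 hf1 ω ε h
    rw [Fintype.sum_prod_type]
    calc ∑ a, ∑ k, f a * X (a, k) ω ^ 2 = ∑ a, f a * ∑ k, X (a, k) ω ^ 2 := by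
          simp_rw [Finset.mul_sum]
      _ ≤ ∑ a, f a * ε ^ 2 := Finset.sum_le_sum fun a _ =>
          mul_le_mul_of_nonneg_left (h a) (hf0 a)
      _ = (∑ a, f a) * ε ^ 2 := by rw [Finset.sum_mul]
      _ ≤ ε ^ 2 := mul_le_of_le_one_left (sq_nonneg ε) hf1
  -- Below this threshold the exponential parameter would be too large, but then |D| ≤ ε² ≤ σ²/9216
  -- ≤ t₁σ holds deterministically.
  by_cases hcase : σ < 24 * K
  · refine ⟨∅, by simp; positivity, fun ω _ ε h3 h4 h5 => ?_⟩
    have h6 : |D ω| ≤ ε ^ 2 := by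
      refine (Finset.abs_sum_le_sum_abs _ _).trans ?_
      simp only [abs_mul, abs_pow, sq_abs, c]
      refine hrow (fun a => |u a| * |w a|) (fun a => by positivity) ?_ ω ε h5
      calc ∑ a, |u a| * |w a| ≤ ∑ a, (u a ^ 2 + w a ^ 2) / 2 :=
            Finset.sum_le_sum fun a _ => by
              nlinarith [sq_nonneg (|u a| - |w a|), sq_abs (u a), sq_abs (w a)]
        _ = 1 := by rw [← Finset.sum_div, Finset.sum_add_distrib, hu, hw]; norm_num
    calc |D ω| ≤ ε ^ 2 := h6
      _ ≤ (σ / 96) ^ 2 := by gcongr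
      _ = σ / 9216 * σ := by ring
      _ ≤ t₁ * σ := by gcongr; linarith
  rw [not_lt] at hcase
  -- Then l t₁ σ = 3t₁/K: one half covers L, the other the compensator, at most 18/9216.
  set l := 3 / (K * σ) with hl
  have hl0 : 0 < l := by positivity
  have hlK : ∀ q, |l * c q| * K ^ 2 ≤ 1 / 8 := fun q => by
    rw [abs_mul, abs_of_pos hl0]
    calc l * |c q| * K ^ 2 ≤ l * 1 * K ^ 2 := by gcongr; exact hc1 q
      _ = 3 * K / σ := by rw [hl]; field_simp
      _ ≤ 1 / 8 := by rw [div_le_iff₀ hσ]; linarith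
  have hA := measureReal_sq_ge_le hX hm hK h2 hc0 hlK L
  have hB := measureReal_sq_ge_le hX hm hK h2 (c := fun q => -c q) (by simpa using hc0)
    (fun q => by simpa using hlK q) L
  refine ⟨_ ∪ _, (measureReal_union_le _ _).trans ((add_le_add hA hB).trans_eq (by ring)), ?_⟩
  intro ω hω ε h3 h4 h5
  simp only [Set.mem_union, not_or, Set.mem_ofPred_eq, not_le, sub_mul, Finset.sum_sub_distrib,
    mul_neg, neg_mul, Finset.sum_neg_distrib, neg_sq] at hω
  have h6 : ∑ q, 2 * (l * c q) ^ 2 * K ^ 2 * X q ω ^ 2 ≤ 2 * l ^ 2 * K ^ 2 * ε ^ 2 := by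
    have : ∑ q, 2 * (l * c q) ^ 2 * K ^ 2 * X q ω ^ 2 =
        2 * l ^ 2 * K ^ 2 * ∑ q : ι × κ, (u q.1 * w q.1) ^ 2 * X q ω ^ 2 := by
      rw [Finset.mul_sum]
      exact Finset.sum_congr rfl fun q _ => by simp only [c]; ring
    rw [this]
    refine mul_le_mul_of_nonneg_left (hrow (fun a => (u a * w a) ^ 2) (fun a => sq_nonneg _)
      ?_ ω ε h5) (by positivity)
    rw [← hu]
    refine Finset.sum_le_sum fun a _ => ?_
    rw [mul_pow]
    exact mul_le_of_le_one_right (sq_nonneg _) ((sq_le_one_iff_abs_le_one _).2 (hw1 a))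
  have h7 : ∑ q, l * c q * X q ω ^ 2 = l * D ω := by
    rw [Finset.mul_sum]; exact Finset.sum_congr rfl fun q _ => by ring
  rw [h7] at hω
  have h8 : l * |D ω| ≤ L + 2 * l ^ 2 * K ^ 2 * ε ^ 2 := by
    rw [← abs_of_pos hl0, ← abs_mul, abs_of_pos hl0, abs_le]
    constructor <;> linarith [hω.1, hω.2]
  have h9 : L + 2 * l ^ 2 * K ^ 2 * ε ^ 2 ≤ l * (t₁ * σ) := by
    calc L + 2 * l ^ 2 * K ^ 2 * ε ^ 2 ≤ L + 2 * l ^ 2 * K ^ 2 * (σ / 96) ^ 2 := by gcongr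
      _ = L + 18 / 9216 := by rw [hl]; field_simp; ring
      _ ≤ 3 / 2 * (t₁ / K) + 3 / 2 * (t₁ / K) := by
        have e1 : L ≤ 3 / 2 * (t₁ / K) := by
          rw [mul_div_assoc', le_div_iff₀ hK0]; linarith
        have e2 : 1 ≤ t₁ / K := by rwa [one_le_div hK0]
        linarith
      _ = l * (t₁ * σ) := by rw [hl]; field_simp; ring
  exact le_of_mul_le_mul_left (h8.trans h9) hl0

end Tails

/-! ### The noise event and the rank one case. -/

section RandomMatrix

theorem sum_row_sq_le {m n : ℕ} (M : Matrix (Fin m) (Fin n) ℝ) (a : Fin m) :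
    ∑ k, M a k ^ 2 ≤ ‖M‖ ^ 2 := by
  have h := (ContinuousLinearMap.adjoint (matCLM M)).le_opNorm (EuclideanSpace.single a 1)
  rw [LinearIsometryEquiv.norm_map, norm_matCLM, PiLp.norm_single, norm_one,
    mul_one] at h
  have h2 := pow_le_pow_left₀ (norm_nonneg _) h 2
  rw [EuclideanSpace.norm_sq_eq] at h2
  simpa [adjoint_matCLM_apply] using h2

theorem sum_col_sq_le {m n : ℕ} (M : Matrix (Fin m) (Fin n) ℝ) (b : Fin n) :
    ∑ k, M k b ^ 2 ≤ ‖M‖ ^ 2 := by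
  have h := (matCLM M).le_opNorm (EuclideanSpace.single b 1)
  rw [norm_matCLM, PiLp.norm_single, norm_one, mul_one] at h
  have h2 := pow_le_pow_left₀ (norm_nonneg _) h 2
  rw [EuclideanSpace.norm_sq_eq] at h2
  simpa [matCLM_apply] using h2

theorem inner_matCLM {m n : ℕ} (M : Matrix (Fin m) (Fin n) ℝ) (x : EuclideanSpace ℝ (Fin m))
    (y : EuclideanSpace ℝ (Fin n)) :
    inner ℝ x (matCLM M y) = ∑ q : Fin m × Fin n, x q.1 * y q.2 * M q.1 q.2 := by
  rw [PiLp.inner_apply, Fintype.sum_prod_type]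
  refine Finset.sum_congr rfl fun i _ => ?_
  rw [matCLM_apply]
  simp only [RCLike.inner_apply, conj_trivial, Finset.sum_mul]
  exact Finset.sum_congr rfl fun j _ => by ring

theorem inner_adjoint_matCLM {m n : ℕ} (M : Matrix (Fin m) (Fin n) ℝ)
    (x y : EuclideanSpace ℝ (Fin m)) :
    inner ℝ (ContinuousLinearMap.adjoint (matCLM M) x)
      (ContinuousLinearMap.adjoint (matCLM M) y) =
      ∑ k, (∑ a, x a * M a k) * (∑ b, y b * M b k) := by
  rw [PiLp.inner_apply]
  refine Finset.sum_congr rfl fun k _ => ?_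
  simp only [adjoint_matCLM_apply, RCLike.inner_apply, conj_trivial]
  rw [mul_comm]
  simp_rw [mul_comm (M _ _)]

theorem inner_matCLM_matCLM {m n : ℕ} (M : Matrix (Fin m) (Fin n) ℝ)
    (x y : EuclideanSpace ℝ (Fin n)) :
    inner ℝ (matCLM M x) (matCLM M y) =
      ∑ k, (∑ a, x a * M k a) * (∑ b, y b * M k b) := by
  rw [PiLp.inner_apply]
  refine Finset.sum_congr rfl fun k _ => ?_
  simp only [matCLM_apply, RCLike.inner_apply, conj_trivial]
  rw [mul_comm]
  simp_rw [mul_comm (M _ _)]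

theorem Orthonormal.sum_sq_eq_one {ι : Type*} {N : ℕ} {u : ι → EuclideanSpace ℝ (Fin N)}
    (hu : Orthonormal ℝ u) (i : ι) : ∑ a, u i a ^ 2 = 1 := by
  have h := hu.1 i
  have h2 := EuclideanSpace.norm_sq_eq (u i)
  rw [h] at h2
  simpa using h2.symm

theorem Orthonormal.sum_mul_eq_zero {ι : Type*} {N : ℕ} {u : ι → EuclideanSpace ℝ (Fin N)}
    (hu : Orthonormal ℝ u) {i j : ι} (hij : i ≠ j) : ∑ a, u i a * u j a = 0 := by
  have h : inner ℝ (u i) (u j) = 0 := hu.2 hij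
  rw [PiLp.inner_apply] at h
  simpa [mul_comm] using h

theorem mFour_eq_one {Ω : Type*} [MeasurableSpace Ω] {μ : Measure Ω} {m n : ℕ} (hm : 0 < m)
    (hn : 0 < n) {E : Ω → Matrix (Fin m) (Fin n) ℝ}
    (h : ∀ i j, variance (fun ω => E ω i j) μ = 1) : mFour μ E = 1 := by
  have : Nonempty (Fin m) := ⟨⟨0, hm⟩⟩
  have : Nonempty (Fin n) := ⟨⟨0, hn⟩⟩
  have hm' : (m : ℝ) ≠ 0 := by positivity
  have hn' : (n : ℝ) ≠ 0 := by positivity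
  simp [mFour, h, hm', hn']

/-- The bad set need not be measurable, so the good event is the complement of its measurable hull,
which has the same measure. -/
theorem exists_measurable_compl_le {Ω : Type*} [MeasurableSpace Ω] (μ : Measure Ω)
    [IsProbabilityMeasure μ] {S : Set Ω} {b : ℝ} (hS : μ.real S ≤ b) :
    ∃ G : Set Ω, MeasurableSet G ∧ 1 - b ≤ μ.real G ∧ ∀ ω ∈ G, ω ∉ S := by
  refine ⟨(toMeasurable μ S)ᶜ, (measurableSet_toMeasurable μ S).compl, ?_, fun ω hω h =>
    hω (subset_toMeasurable μ S h)⟩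
  rw [probReal_compl_eq_one_sub (measurableSet_toMeasurable μ S), measureReal_def,
    measure_toMeasurable, ← measureReal_def]
  linarith

/-- With the stated probability, the noise has small entries, and nearly orthogonal rows and
columns, in the basis of the singular vectors. -/
theorem exists_noise_event {Ω : Type*} [MeasurableSpace Ω] {μ : Measure Ω}
    [IsProbabilityMeasure μ] {m n r : ℕ} {E : Ω → Matrix (Fin m) (Fin n) ℝ} {K : ℝ}
    (hX : iIndepFun (fun (ij : Fin m × Fin n) (ω : Ω) => E ω ij.1 ij.2) μ)
    (hm : ∀ ij : Fin m × Fin n, AEMeasurable (fun ω => E ω ij.1 ij.2) μ)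
    (hK : ∀ ij : Fin m × Fin n, ∀ᵐ ω ∂μ, |E ω ij.1 ij.2| ≤ K) (hK0 : 0 < K)
    (h1 : ∀ ij : Fin m × Fin n, ∫ ω, E ω ij.1 ij.2 ∂μ = 0)
    (h2 : ∀ ij : Fin m × Fin n, ∫ ω, E ω ij.1 ij.2 ^ 2 ∂μ = 1)
    {u : Fin r → EuclideanSpace ℝ (Fin m)} {v : Fin r → EuclideanSpace ℝ (Fin n)}
    (hu : Orthonormal ℝ u) (hv : Orthonormal ℝ v) {t₁ t₂ σ : ℝ} (ht₁ : 0 < t₁) (ht₂ : 0 < t₂)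
    (hKt : K ≤ t₁) (hσ : 0 < σ) :
    ∃ S : Set Ω, μ.real S ≤ (r : ℝ) ^ 2 * (2 * Real.exp (-(3 * (t₁ ^ 2 / 2 / (4 + K * t₁))))) +
        (r : ℝ) * (r - 1) * (4 * Real.exp (-(3 * (t₁ ^ 2 / 2 / (4 + K * t₁)))) +
          2 * (m + n) / t₂ ^ 2) ∧
      ∀ ω ∉ S, ‖E ω‖ ≤ σ / 96 →
        (∀ i j, |inner ℝ (u i) (matCLM (E ω) (v j))| ≤ 2 * t₁) ∧
        (∀ i j, i ≠ j → |inner ℝ (ContinuousLinearMap.adjoint (matCLM (E ω)) (u i))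
          (ContinuousLinearMap.adjoint (matCLM (E ω)) (u j))| ≤ t₂ + t₁ * σ) ∧
        (∀ i j, i ≠ j → |inner ℝ (matCLM (E ω) (v i)) (matCLM (E ω) (v j))| ≤ t₂ + t₁ * σ) := by
  set L := 3 * (t₁ ^ 2 / 2 / (4 + K * t₁)) with hL
  have hKL : K * L ≤ 3 / 2 * t₁ := by
    have hKt : 0 < K * t₁ := by positivity
    rw [hL, mul_left_comm, mul_div_assoc', ← mul_div_assoc, div_le_iff₀ (by positivity)]
    nlinarith
  have hlin : ∀ q : Fin r × Fin r,
      μ.real {ω | 2 * t₁ ≤ |inner ℝ (u q.1) (matCLM (E ω) (v q.2))|} ≤ 2 * Real.exp (-L) := by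
    intro q
    simp_rw [inner_matCLM]
    refine measureReal_abs_linear_ge_le (c := fun ij => u q.1 ij.1 * v q.2 ij.2) hX hm hK hK0.le
      h1 h2 (le_of_eq ?_) ht₁
    simp_rw [mul_pow, Fintype.sum_prod_type, ← Finset.mul_sum, hv.sum_sq_eq_one, mul_one,
      hu.sum_sq_eq_one]
  have hquadU : ∀ q : Fin r × Fin r, ∃ S : Set Ω, q.1 ≠ q.2 →
      μ.real S ≤ 2 * Real.exp (-L) + 2 * n / t₂ ^ 2 ∧ ∀ ω ∉ S, ‖E ω‖ ≤ σ / 96 →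
        |inner ℝ (ContinuousLinearMap.adjoint (matCLM (E ω)) (u q.1))
          (ContinuousLinearMap.adjoint (matCLM (E ω)) (u q.2))| ≤ t₂ + t₁ * σ := by
    intro q
    by_cases hq : q.1 = q.2
    · exact ⟨∅, fun h => (h hq).elim⟩
    obtain ⟨S, hS, hS'⟩ := exists_quadratic_tail hX hm hK hK0 h1 h2 (hu.sum_sq_eq_one q.1)
      (hu.sum_sq_eq_one q.2) (hu.sum_mul_eq_zero hq) ht₂ hKt hσ hKL
    refine ⟨S, fun _ => ⟨by simpa using hS, fun ω hω hE => ?_⟩⟩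
    rw [inner_adjoint_matCLM]
    exact hS' ω hω ‖E ω‖ hE (norm_nonneg _) (sum_row_sq_le (E ω))
  have hquadV : ∀ q : Fin r × Fin r, ∃ S : Set Ω, q.1 ≠ q.2 →
      μ.real S ≤ 2 * Real.exp (-L) + 2 * m / t₂ ^ 2 ∧ ∀ ω ∉ S, ‖E ω‖ ≤ σ / 96 →
        |inner ℝ (matCLM (E ω) (v q.1)) (matCLM (E ω) (v q.2))| ≤ t₂ + t₁ * σ := by
    intro q
    by_cases hq : q.1 = q.2
    · exact ⟨∅, fun h => (h hq).elim⟩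
    -- The column version is the row version for the transposed array.
    obtain ⟨S, hS, hS'⟩ := exists_quadratic_tail (hX.precomp Prod.swap_injective)
      (fun ij => hm ij.swap) (fun ij => hK ij.swap) hK0 (fun ij => h1 ij.swap)
      (fun ij => h2 ij.swap) (hv.sum_sq_eq_one q.1)
      (hv.sum_sq_eq_one q.2) (hv.sum_mul_eq_zero hq) ht₂ hKt hσ hKL
    refine ⟨S, fun _ => ⟨by simpa using hS, fun ω hω hE => ?_⟩⟩
    rw [inner_matCLM_matCLM]
    exact hS' ω hω ‖E ω‖ hE (norm_nonneg _) (sum_col_sq_le (E ω))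
  choose SU hSU using hquadU
  choose SV hSV using hquadV
  let D : Finset (Fin r × Fin r) := Finset.univ.offDiag
  have hD : ∀ q ∈ D, q.1 ≠ q.2 := fun q hq => (Finset.mem_offDiag.1 hq).2.2
  have hDcard : (D.card : ℝ) = r * (r - 1) := by
    simp only [D, Finset.offDiag_card, Finset.card_univ, Fintype.card_fin]
    rw [Nat.cast_sub (Nat.le_mul_self r)]
    push_cast; ring
  refine ⟨(⋃ q ∈ (Finset.univ : Finset (Fin r × Fin r)),
      {ω | 2 * t₁ ≤ |inner ℝ (u q.1) (matCLM (E ω) (v q.2))|}) ∪ ⋃ q ∈ D, (SU q ∪ SV q),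
    (measureReal_union_le _ _).trans (add_le_add ?_ ?_), ?_⟩
  · refine (measureReal_biUnion_finset_le _ _).trans
      ((Finset.sum_le_sum fun q _ => hlin q).trans_eq ?_)
    simp [sq]
  · refine (measureReal_biUnion_finset_le _ _).trans
      ((Finset.sum_le_sum fun q hq => (measureReal_union_le _ _).trans
        (add_le_add (hSU q (hD q hq)).1 (hSV q (hD q hq)).1)).trans_eq ?_)
    rw [Finset.sum_const, nsmul_eq_mul, hDcard]
    ring
  · intro ω hω hE
    simp only [Set.mem_union, Set.mem_iUnion, not_or, not_exists, Finset.mem_univ,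
      Set.mem_ofPred_eq, not_le, forall_true_left] at hω
    have hmem : ∀ i j : Fin r, i ≠ j → (i, j) ∈ D := fun i j hij =>
      Finset.mem_offDiag.2 ⟨Finset.mem_univ _, Finset.mem_univ _, hij⟩
    exact ⟨fun i j => (hω.1 (i, j)).le,
      fun i j hij => (hSU (i, j) hij).2 ω (hω.2 (i, j) (hmem i j hij)).1 hE,
      fun i j hij => (hSV (i, j) hij).2 ω (hω.2 (i, j) (hmem i j hij)).2 hE⟩

theorem abs_inner_matCLM_le {m n r : ℕ} (M : Matrix (Fin m) (Fin n) ℝ)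
    {u : Fin r → EuclideanSpace ℝ (Fin m)} {v : Fin r → EuclideanSpace ℝ (Fin n)}
    (hu : Orthonormal ℝ u) (hv : Orthonormal ℝ v) (i j : Fin r) :
    |inner ℝ (u i) (matCLM M (v j))| ≤ ‖M‖ := by
  refine (abs_real_inner_le_norm _ _).trans ?_
  rw [hu.1 i, one_mul]
  refine ((matCLM M).le_opNorm _).trans_eq ?_
  rw [hv.1 j, mul_one, norm_matCLM]

/-- In rank one the truncation bound holds without any assumption on the entries of the noise. -/
theorem norm_truncation_sub_le_of_rank_eq_one {m n : ℕ} {A E Ap Bp : Matrix (Fin m) (Fin n) ℝ}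
    (hr : A.rank = 1) (hgap : 0 < singGap A 1) (hAp : IsRankTruncation A 1 Ap)
    (hB : IsRankTruncation (A + E) 1 Bp) (hEσ : ‖E‖ ≤ singVal A 1 / 96)
    (hEδ : A.rank * ‖E‖ ^ 2 ≤ singVal A 1 * singGap A 1 / 9216) :
    ‖Bp - Ap‖ ≤ 12 * ‖E‖ := by
  obtain ⟨u, v, hA, -⟩ := hAp.exists_isSVD
  have hσ2 : singVal A 2 = 0 := by
    refine le_antisymm (not_lt.1 fun h => ?_) (singVal_nonneg _ _)
    have := le_rank_of_singVal_pos _ h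
    omega
  have hδ : singGap A 1 = singVal A 1 := by rw [singGap, hσ2, sub_zero]
  have hσ : singVal A 1 ≠ 0 := by rw [← hδ]; exact hgap.ne'
  have hsub : ∀ i j : Fin A.rank, i ≠ j → False := fun i j hij => hij (by ext; omega)
  -- Here σ₂ = 0, so δ = σ, and x = ‖E‖ is admissible with ratio σ/δ = 1; the conditions on distinct
  -- indices are vacuous. The constant is 5 + 7.
  have h := norm_truncation_sub_le le_rfl hr.ge hgap hA hAp hB (norm_nonneg E) le_rfl hEσ hEδ
    (by rw [hr, hδ]; push_cast; linarith [norm_nonneg E])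
    (abs_inner_matCLM_le E hA.left hA.right)
    (fun i j hij => (hsub i j hij).elim) (fun i j hij => (hsub i j hij).elim)
  rw [hr, hδ, div_self hσ] at h
  refine h.trans_eq ?_
  push_cast; ring

end RandomMatrix

/-! ### Choice of the event and of the constants. -/

theorem mainTheorem7 {Ω : Type*} [MeasurableSpace Ω] (μ : Measure Ω) [IsProbabilityMeasure μ]
    (m n r p : ℕ) (hmn : m ≤ n)
    (A : Matrix (Fin m) (Fin n) ℝ) (hA : A.rank = r)
    (hp : 1 ≤ p) (hpr : p ≤ r) (hgap : 0 < singGap A p)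
    (E : Ω → Matrix (Fin m) (Fin n) ℝ) (K : ℝ)
    (h_indep : iIndepFun (fun (ij : Fin m × Fin n) (ω : Ω) => E ω ij.1 ij.2) μ)
    (h_ident : ∀ ij kl : Fin m × Fin n,
      IdentDistrib (fun ω => E ω ij.1 ij.2) (fun ω => E ω kl.1 kl.2) μ μ)
    (h_bdd : ∀ᵐ ω ∂μ, ∀ i j, |E ω i j| ≤ K)
    (h_mean : ∀ i j, ∫ ω, E ω i j ∂μ = 0)
    (h_var : ∀ i j, variance (fun ω => E ω i j) μ = 1)
    (t₁ t₂ : ℝ) (ht₁ : 0 < t₁) (ht₂ : 0 < t₂) :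
    ∃ G : Set Ω, MeasurableSet G ∧
      1 - (r : ℝ) ^ 2 * Real.exp (-(t₁ ^ 2 / 2) / (4 + K * t₁))
        - 5 * (r : ℝ) * ((r : ℝ) - 1) * ((m : ℝ) + (n : ℝ)) * mFour μ E / t₂ ^ 2 ≤ μ.real G ∧
      ∀ ω ∈ G, CondC0 A (E ω) p t₁ →
        ∀ Ap Bp : Matrix (Fin m) (Fin n) ℝ,
          IsRankTruncation A p Ap → IsRankTruncation (A + E ω) p Bp →
          ‖Bp - Ap‖ ≤ 32 * (‖E ω‖ + (r : ℝ) * t₁ * (singVal A p / singGap A p)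
            + (r : ℝ) ^ 2 * t₂ / singGap A p) := by
  subst hA
  have hr1 : 1 ≤ A.rank := hp.trans hpr
  have hr1' : (1 : ℝ) ≤ A.rank := by exact_mod_cast hr1
  have hm0 : 0 < m := hr1.trans (by simpa using A.rank_le_height)
  have hn0 : 0 < n := hm0.trans_le hmn
  have hσ : 0 < singVal A p := by
    have := singVal_nonneg A (p + 1)
    rw [singGap] at hgap; linarith
  have hm : ∀ ij : Fin m × Fin n, AEMeasurable (fun ω => E ω ij.1 ij.2) μ :=
    fun ij => (h_ident ij ij).aemeasurable_fst
  have hK : ∀ ij : Fin m × Fin n, ∀ᵐ ω ∂μ, |E ω ij.1 ij.2| ≤ K := fun ij => by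
    filter_upwards [h_bdd] with ω hω using hω _ _
  have h2 : ∀ ij : Fin m × Fin n, ∫ ω, E ω ij.1 ij.2 ^ 2 ∂μ = 1 := fun ij => by
    rw [← h_var ij.1 ij.2, variance_of_integral_eq_zero (hm ij) (h_mean _ _)]
  have hK0 : 0 < K := by
    by_contra! hneg
    have h0 : ∀ᵐ ω ∂μ, E ω ⟨0, hm0⟩ ⟨0, hn0⟩ ^ 2 = (0 : ℝ) := by
      filter_upwards [hK (⟨0, hm0⟩, ⟨0, hn0⟩)] with ω hω
      have h3 : E ω ⟨0, hm0⟩ ⟨0, hn0⟩ = 0 := abs_nonpos_iff.1 (hω.trans hneg)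
      rw [h3]; norm_num
    have := h2 (⟨0, hm0⟩, ⟨0, hn0⟩)
    rw [integral_congr_ae h0] at this
    simp at this
  rw [mFour_eq_one hm0 hn0 h_var, mul_one]
  have hrr : 0 ≤ (A.rank : ℝ) * ((A.rank : ℝ) - 1) := mul_nonneg (by linarith) (by linarith)
  have hlast : 0 ≤ 5 * (A.rank : ℝ) * ((A.rank : ℝ) - 1) * ((m : ℝ) + n) / t₂ ^ 2 := by
    rw [mul_assoc 5]; positivity
  -- Absorbing the prefactors below uses r² ≥ 4, so rank one is handled deterministically on the
  -- whole space.
  rcases hr1.eq_or_lt with hone | htwo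
  · obtain rfl : p = 1 := by omega
    refine ⟨Set.univ, MeasurableSet.univ, ?_, fun ω _ hC Ap Bp hAp hBp => ?_⟩
    · rw [probReal_univ]
      have : 0 ≤ (A.rank : ℝ) ^ 2 * Real.exp (-(t₁ ^ 2 / 2) / (4 + K * t₁)) := by positivity
      linarith
    · obtain ⟨hE1, hE2, -⟩ := hC.bounds hp hpr ht₁ hgap
      refine (norm_truncation_sub_le_of_rank_eq_one hone.symm hgap hAp hBp hE1 hE2).trans ?_
      have e1 : 0 ≤ (A.rank : ℝ) * t₁ * (singVal A 1 / singGap A 1) := by positivity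
      have e2 : 0 ≤ (A.rank : ℝ) ^ 2 * t₂ / singGap A 1 := by positivity
      linarith [norm_nonneg (E ω)]
  have hr2 : (2 : ℝ) ≤ A.rank := by exact_mod_cast htwo
  set z := t₁ ^ 2 / 2 / (4 + K * t₁) with hz
  rw [neg_div, ← hz]
  -- If the claimed probability is not positive, the empty event works. Otherwise exp(-z) ≤ 1/4,
  -- hence z ≥ 3/4, which forces K ≤ t₁.
  by_cases htriv : 1 ≤ (A.rank : ℝ) ^ 2 * Real.exp (-z)
  · refine ⟨∅, MeasurableSet.empty, ?_, by simp⟩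
    rw [measureReal_empty]; linarith
  have hexp : Real.exp (-z) ≤ 1 / 4 := by
    have : 4 * Real.exp (-z) ≤ (A.rank : ℝ) ^ 2 * Real.exp (-z) := by
      gcongr; nlinarith
    linarith
  have hKt : K ≤ t₁ := by
    have h3 : 3 / 4 ≤ z := by linarith [Real.add_one_le_exp (-z)]
    have h4 : 0 < K * t₁ := by positivity
    rw [hz, le_div_iff₀ (by positivity)] at h3
    have h5 : K * t₁ ≤ t₁ * t₁ := by nlinarith
    exact le_of_mul_le_mul_right h5 ht₁
  obtain ⟨A₀, hA₀⟩ := exists_isRankTruncation A p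
  obtain ⟨u, v, hsvd, -⟩ := hA₀.exists_isSVD
  obtain ⟨S, hS, hS'⟩ := exists_noise_event h_indep hm hK hK0 (fun ij => h_mean _ _) h2
    hsvd.left hsvd.right ht₁ ht₂ hKt hσ
  obtain ⟨G, hG, hGS, hG'⟩ := exists_measurable_compl_le μ hS
  refine ⟨G, hG, le_trans ?_ hGS, fun ω hω hC Ap Bp hAp hBp => ?_⟩
  · rw [← hz]
    have h3 : Real.exp (-(3 * z)) = Real.exp (-z) ^ 3 := by
      rw [← Real.exp_nat_mul]; congr 1; push_cast; ring
    -- The union bound costs at most 6r² exp(-3z), and exp(-2z) ≤ 1/16 reduces this below r²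
    -- exp(-z).
    have h4 : 16 * Real.exp (-(3 * z)) ≤ Real.exp (-z) := by
      have := Real.exp_pos (-z)
      rw [h3]
      nlinarith [mul_le_mul hexp hexp this.le (by norm_num)]
    have hs0 := Real.exp_pos (-(3 * z))
    have h5 : (A.rank : ℝ) * (A.rank - 1) * (4 * Real.exp (-(3 * z))) ≤
        (A.rank : ℝ) ^ 2 * (4 * Real.exp (-(3 * z))) := by
      gcongr; nlinarith
    have h6 : (A.rank : ℝ) ^ 2 * (16 * Real.exp (-(3 * z))) ≤ (A.rank : ℝ) ^ 2 * Real.exp (-z) := by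
      gcongr
    have h7 : (A.rank : ℝ) * (A.rank - 1) * (2 * (m + n) / t₂ ^ 2) ≤
        5 * (A.rank : ℝ) * ((A.rank : ℝ) - 1) * ((m : ℝ) + n) / t₂ ^ 2 := by
      have : 0 ≤ (A.rank : ℝ) * (A.rank - 1) * (3 * (m + n) / t₂ ^ 2) := by positivity
      have e : 5 * (A.rank : ℝ) * ((A.rank : ℝ) - 1) * ((m : ℝ) + n) / t₂ ^ 2 =
        (A.rank : ℝ) * (A.rank - 1) * (2 * (m + n) / t₂ ^ 2) +
          (A.rank : ℝ) * (A.rank - 1) * (3 * (m + n) / t₂ ^ 2) := by ring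
      linarith
    have h8 : 0 ≤ (A.rank : ℝ) ^ 2 * Real.exp (-(3 * z)) := by positivity
    linarith
  · obtain ⟨hE1, hE2, hE3⟩ := hC.bounds hp hpr ht₁ hgap
    obtain ⟨hx, hy, hy'⟩ := hS' ω (hG' ω hω) hE1
    refine (norm_truncation_sub_le hp hpr hgap hsvd hAp hBp (by positivity) (by positivity)
      hE1 hE2 hE3 hx hy hy').trans ?_
    set R := (A.rank : ℝ)
    set s := singVal A p
    set d := singGap A p
    -- With x = 2t₁ and y = t₂ + t₁σ_p the bound is 5‖E‖ + 21 R t₁ s/d + 7 R t₂/d, within the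
    -- constant 32.
    have e1 : R * (2 * t₁) * (s / d) = 2 * (R * t₁ * (s / d)) := by ring
    have e2 : R * (t₂ + t₁ * s) / d = R * t₂ / d + R * t₁ * (s / d) := by ring
    have e3 : R * t₂ / d ≤ R ^ 2 * t₂ / d := by gcongr; nlinarith
    have e4 : 0 ≤ R * t₁ * (s / d) := by positivity
    have e5 : 0 ≤ R ^ 2 * t₂ / d := by positivity
    rw [e1, e2]
    linarith [norm_nonneg (E ω)]
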